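/- **Theorem (heterogeneous lower bound with predefined deterministic local functions).** There exist universal constants $c', c_1, c_2, c_3 > 0$ such that the following holds. *Computation model.* Let $n \ge 1$ and let $v_1,\dots,v_n : [0,\infty) \to [0,\infty)$ be almost everywhere continuous and integrable on bounded intervals. Put $V_i(t) = \int_0^t v_i(\tau)\,d\tau$ for $t \in [0,\infty]$. *Protocol.* An algorithm is a sequence $A = \{A^k\}_{k \ge 0}$ of maps $A^k : (\mathbb{R}^d)^k \to [0,\infty)\times\{1,\dots,n\}\times\{0,1\}\times\mathbb{R}^d$. Each oracle $i$ has a state $s_i^k \in [0,\infty)\times\mathbb{R}^d\times\{0,1\}$, with $s_i^0 = (0,0,0)$. For $k = 0,1,2,\dots$ one sets $$(t^{k+1}, i^{k+1}, c^{k+1}, x^k) = A^k(g^1,\dots,g^k), \qquad (s^{k+1}_{i^{k+1}}, g^{k+1}) = O_{i^{k+1}}(t^{k+1}, x^k, s^k_{i^{k+1}}, c^{k+1}),$$ $s^{k+1}_j = s^k_j$ for $j \ne i^{k+1}$, and $t^0 = 0$, where $$O_i(t,x,(s_t,s_x,s_q),c) = \begin{cases} ((t,x,1),\,0), & c=0,\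 s_q=0,\\ ((s_t,s_x,1),\,0), & c=0,\ s_q=1,\ V_i(t)-V_i(s_t)<1,\\ ((0,0,0),\,g_i(s_x;\xi,t)), & c=0,\ s_q=1,\ V_i(t)-V_i(s_t)\ge 1,\\ ((0,0,0),\,0), & c=1,\end{cases}$$ and $\xi$ is a fresh independent draw from a distribution $\mathcal{D}$. The algorithm is zero-respecting ($A \in \mathcal{A}_{\mathrm{zr}}$) if, for all $k$ and all inputs, $\mathrm{supp}(x^k) \subseteq \bigcup_{j=1}^k \mathrm{supp}(g^j)$ and the returned times are non-decreasing in $k$. *Lower bound sequence.* Let $L,\Delta,\varepsilon>0$ and $\sigma \ge 0$ with $\varepsilon < c' L\Delta$. Put $\underline t_0 = 0$ and, for $k \ge 1$, $$\underline t_k = \min\left\{t \ge 0 : \left(\frac1n\sum_{i=1}^n \left\lfloor c_3\,\frac{V_i(t)-V_i(\underline t_{k-1})}{\log(L\Delta/\varepsilon)}\right\rfloor^{-1}\right)^{-1} \ge \max\left\{c_2\,\frac{\sigma^2}{n\varepsilon},\,1\right\}\right\},$$ with the conventions $\min\emptyset = \infty$, $0^{-1}=\infty$, $\infty^{-1}=0$,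 and with negative floors read as $0$. *Claim.* For every sufficiently large dimension $d$ (depending on $n$, $\{v_i\}$, $L,\Delta,\varepsilon,\sigma$) and every $A \in \mathcal{A}_{\mathrm{zr}}$ on $\mathbb{R}^d$ there exist (deterministic) differentiable functions $f_1,\dots,f_n : \mathbb{R}^d \to \mathbb{R}$, a distribution $\mathcal{D}$ and stochastic gradient mappings $g_1,\dots,g_n$ such that 1. $f = \frac1n\sum_{i=1}^n f_i$ satisfies $\|\nabla f(x)-\nabla f(y)\| \le L\|x-y\|$ for all $x,y$, and there is $f^*\in\mathbb{R}$ with $f(x) \ge f^*$ for all $x$ and $f(0)-f^* \le \Delta$; 2. $\mathbb{E}_{\xi\sim\mathcal{D}}[g_i(x;\xi,t)] = \nabla f_i(x)$ and $\mathbb{E}_{\xi\sim\mathcal{D}}\|g_i(x;\xi,t)-\nabla f_i(x)\|^2 \le \sigma^2$ for all $x\in\mathbb{R}^d$, $i$ and $t\ge 0$; 3. $\displaystyle \mathbb{E}\Big[\inf_{k\in S_t}\|\nabla f(x^k)\|^2\Big] > \varepsilon$, where $S_t = \{k \in \{0,1,2,\dots\} : t^k \le t\}$ and $\displaystyle t =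 \frac12\,\underline t_{\left\lfloor c_1\frac{L\Delta/\varepsilon}{\log(L\Delta/\varepsilon)}\right\rfloor}$ (possibly $t = \infty$, in which case $S_t$ contains all $k$). -/

import Mathlib

open scoped NNReal ENNReal

noncomputable section

namespace TimeOracle

/-- `ℝ^d` with the Euclidean norm. -/
abbrev Vec (d : ℕ) : Type := EuclideanSpace ℝ (Fin d)

/-! ### The universal computation model -/

/-- A computation power: non-negative and almost everywhere continuous on `[0, ∞)`, with a finite
integral over every bounded interval (so that `V` below is finite on `[0, ∞)`). Only the values on
`[0, ∞)` matter. -/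
structure IsComputationPower (v : ℝ → ℝ) : Prop where
  nonneg : ∀ τ : ℝ, 0 ≤ τ → 0 ≤ v τ
  ae_continuous : ∀ᵐ τ ∂(MeasureTheory.volume.restrict (Set.Ici (0 : ℝ))),
    ContinuousWithinAt v (Set.Ici 0) τ
  integrableOn : ∀ T : ℝ, MeasureTheory.IntegrableOn v (Set.Icc 0 T)

/-- `V(t) = ∫_0^t v(τ) dτ` for `t ∈ [0, ∞]`. -/
def work (v : ℝ → ℝ) (t : ℝ≥0∞) : ℝ≥0∞ :=
  ∫⁻ τ in {τ : ℝ | 0 ≤ τ ∧ ENNReal.ofReal τ ≤ t}, ENNReal.ofReal (v τ)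

/-! ### Algorithms -/

/-- What an algorithm returns in one iteration: `(t^{k+1}, i^{k+1}, c^{k+1}, x^k)`;
`control = true` stands for `c = 1`. -/
structure Query (n d : ℕ) where
  time : ℝ≥0
  worker : Fin n
  control : Bool
  point : Vec d

/-- `A = {A^k}`, where `A^k` maps `(g^1, …, g^k)` to the next query. -/
abbrev Algorithm (n d : ℕ) : Type := (k : ℕ) → (Fin k → Vec d) → Query n d

/-- The class of zero-respecting algorithms with non-decreasing times. -/
structure IsZeroRespecting {n d : ℕ} (A : Algorithm n d) : Prop where
  supp_subset : ∀ (k : ℕ) (g : Fin k → Vec d) (l : Fin d),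
    (A k g).point l ≠ 0 → ∃ j : Fin k, g j l ≠ 0
  time_mono : ∀ (k : ℕ) (g : Fin (k + 1) → Vec d),
    (A k (fun j => g j.castSucc)).time ≤ (A (k + 1) g).time

/-! ### The oracles and the protocol -/

/-- The state `(s_t, s_x, s_q)` of an oracle; `busy = true` stands for `s_q = 1`. -/
structure OracleState (d : ℕ) where
  time : ℝ≥0
  point : Vec d
  busy : Bool

/-- The state `(0, 0, 0)`. -/
def OracleState.idle (d : ℕ) : OracleState d := ⟨0, 0, false⟩

/-- One call of the oracle of a worker with computation power `v` and stochastic gradient mapping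
`g`, at time `t`, point `x`, state `s`, control variable `c` and with the random draw `ξ`. -/
def oracle {d : ℕ} {Ξ : Type} (v : ℝ → ℝ) (g : Vec d → Ξ → ℝ≥0 → Vec d)
    (t : ℝ≥0) (x : Vec d) (s : OracleState d) (c : Bool) (ξ : Ξ) : OracleState d × Vec d :=
  if c = true then (OracleState.idle d, 0)
  else if s.busy = false then (⟨t, x, true⟩, 0)
  else if work v t - work v s.time < 1 then (s, 0)
  else (OracleState.idle d, g s.point ξ t)

/-- The states `(s^k_i)_i` of the oracles and the vectors `(g^1, …, g^k)` after `k` iterations of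
the time multiple oracles protocol, when `ξ k` is the draw available to the oracle called in
iteration `k`. -/
def run {n d : ℕ} {Ξ : Type} (v : Fin n → ℝ → ℝ) (g : Fin n → Vec d → Ξ → ℝ≥0 → Vec d)
    (A : Algorithm n d) (ξ : ℕ → Ξ) : (k : ℕ) → (Fin n → OracleState d) × (Fin k → Vec d)
  | 0 => (fun _ => OracleState.idle d, Fin.elim0)
  | k + 1 =>
    let h := run v g A ξ k
    let q := A k h.2
    let o := oracle (v q.worker) (g q.worker) q.time q.point (h.1 q.worker) q.control (ξ k)
    (Function.update h.1 q.worker o.1, Fin.snoc h.2 o.2)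

/-- The point `x^k` of the protocol. -/
def iterate {n d : ℕ} {Ξ : Type} (v : Fin n → ℝ → ℝ) (g : Fin n → Vec d → Ξ → ℝ≥0 → Vec d)
    (A : Algorithm n d) (ξ : ℕ → Ξ) (k : ℕ) : Vec d :=
  (A k (run v g A ξ k).2).point

/-- The time `t^k` of the protocol, with `t^0 = 0`. -/
def time {n d : ℕ} {Ξ : Type} (v : Fin n → ℝ → ℝ) (g : Fin n → Vec d → Ξ → ℝ≥0 → Vec d)
    (A : Algorithm n d) (ξ : ℕ → Ξ) : ℕ → ℝ≥0
  | 0 => 0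
  | k + 1 => (A k (run v g A ξ k).2).time

/-- `S_t = {k ∈ ℕ₀ | t^k ≤ t}` for `t ∈ [0, ∞]`. -/
def indicesUpTo {n d : ℕ} {Ξ : Type} (v : Fin n → ℝ → ℝ)
    (g : Fin n → Vec d → Ξ → ℝ≥0 → Vec d) (A : Algorithm n d) (ξ : ℕ → Ξ) (t : ℝ≥0∞) : Set ℕ :=
  {k : ℕ | (time v g A ξ k : ℝ≥0∞) ≤ t}

/-- `inf_{k ∈ S_t} ‖∇f(x^k)‖²`. The index set contains `0`, so it is never empty. -/
def bestSqGrad {n d : ℕ} {Ξ : Type} (v : Fin n → ℝ → ℝ)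
    (g : Fin n → Vec d → Ξ → ℝ≥0 → Vec d) (A : Algorithm n d) (f : Vec d → ℝ) (t : ℝ≥0∞)
    (ξ : ℕ → Ξ) : ℝ :=
  ⨅ k : indicesUpTo v g A ξ t, ‖gradient f (iterate v g A ξ k)‖ ^ 2

/-! ### Function and oracle classes -/

/-- `f = (1/n) ∑ f_i`. -/
def average {n d : ℕ} (f : Fin n → Vec d → ℝ) (x : Vec d) : ℝ := (1 / (n : ℝ)) * ∑ i, f i x

/-- `f` is differentiable and `L`-smooth, bounded from below by some `f^*`, and
`f(0) - f^* ≤ Δ`. -/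
structure InClass {d : ℕ} (L Δ : ℝ) (f : Vec d → ℝ) : Prop where
  differentiable : Differentiable ℝ f
  smooth : ∀ x y : Vec d, ‖gradient f x - gradient f y‖ ≤ L * ‖x - y‖
  gap : ∃ fstar : ℝ, (∀ x : Vec d, fstar ≤ f x) ∧ f 0 - fstar ≤ Δ

/-- `g` is an unbiased stochastic gradient mapping of `f` with variance at most `σ²`, at all points
and times, under `ξ ∼ D`. -/
structure IsStochasticGradient {d : ℕ} {Ξ : Type} [MeasurableSpace Ξ] (σ : ℝ)
    (D : MeasureTheory.Measure Ξ) (f : Vec d → ℝ) (g : Vec d → Ξ → ℝ≥0 → Vec d) : Prop where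
  integrable : ∀ (x : Vec d) (t : ℝ≥0), MeasureTheory.Integrable (fun ξ => g x ξ t) D
  unbiased : ∀ (x : Vec d) (t : ℝ≥0), ∫ ξ, g x ξ t ∂D = gradient f x
  sq_integrable : ∀ (x : Vec d) (t : ℝ≥0),
    MeasureTheory.Integrable (fun ξ => ‖g x ξ t - gradient f x‖ ^ 2) D
  variance_le : ∀ (x : Vec d) (t : ℝ≥0), ∫ ξ, ‖g x ξ t - gradient f x‖ ^ 2 ∂D ≤ σ ^ 2

/-! ### The lower bound sequence -/

/-- `⌊c₃ (V(t) - V(s)) / ℓ⌋`. For `t ≤ s` this is `0`. -/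
def scaledCount (v : ℝ → ℝ) (c₃ ℓ : ℝ) (s : ℝ≥0∞) (t : ℝ≥0) : ℕ :=
  ⌊c₃ * (work v t - work v s).toReal / ℓ⌋₊

/-- `((1/n) ∑ b_i⁻¹)⁻¹` in `[0, ∞]`, with `0⁻¹ = ∞` and `∞⁻¹ = 0`. -/
def harmonicMean {n : ℕ} (b : Fin n → ℕ) : ℝ≥0∞ :=
  ((∑ i, ((b i : ℝ≥0∞))⁻¹) / (n : ℝ≥0∞))⁻¹

/-- The times `t_0 = 0` and
`t_k = min {t ≥ 0 : ((1/n) ∑ ⌊c₃ (V_i(t) - V_i(t_{k-1})) / ℓ⌋⁻¹)⁻¹ ≥ max (c₂ σ² / (n ε)) 1}`,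
where the minimum of the empty set is `∞`. -/
def lowerTime {n : ℕ} (v : Fin n → ℝ → ℝ) (c₂ c₃ ℓ σ ε : ℝ) : ℕ → ℝ≥0∞
  | 0 => 0
  | k + 1 => sInf ((fun t : ℝ≥0 => (t : ℝ≥0∞)) '' {t : ℝ≥0 |
      ENNReal.ofReal (max (c₂ * (σ ^ 2 / (n * ε))) 1) ≤
        harmonicMean (fun i => scaledCount (v i) c₃ ℓ (lowerTime v c₂ c₃ ℓ σ ε k) t)})

end TimeOracle

end

/-!
Each local function is a weighted chain of links between consecutive coordinates: the gradient at a
point whose first `N` coordinates are discovered reveals only coordinate `N + 1`, and the gradient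
of the average stays large until the whole chain is discovered. The stochastic gradient of a worker
shows the new coordinate only if a coin comes up heads, rescaled by the inverse of the heads
probability to remain unbiased, so the bound `σ²` on the variance allows a small heads probability
where the weight of the link is small.

The chain is cut into `K` blocks of length `m` of order `log (LΔ/ε)`, and block `b` is paired with
the time window between the times `b` and `b + 1` of the lower bound sequence. The work `W i` of
worker `i` in this window bounds the number of its gradients by `1 + W i`. If some `W i` is at most
of order `m`, that worker alone carries the block. Otherwise minimality of the end of the window
makes `∑ i, 1 / W i` large, and weights proportional to `1 / W i` leave room for small heads
probabilities. Either way the window has at most `m / 4` heads in expectation. By a Chernoff bound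
for adaptively chosen events and a union bound over the blocks, with probability above `1/2` no
window has `m` heads. By induction, at most `b * m` coordinates are then discovered by time `b` of
the sequence, so the squared gradient norm is at least `2ε` up to time `K`, and Markov's inequality
concludes.
-/

noncomputable section

namespace TimeOracle

/-! ### The scalar building blocks -/

/-- The density `1 / (1 + y²)`, the derivative of `arctan`. -/
def cauchy (y : ℝ) : ℝ := (1 + y ^ 2)⁻¹

/-- The derivative of `1 - cauchy`. -/
def cauchySlope (y : ℝ) : ℝ := 2 * y / (1 + y ^ 2) ^ 2

/-- The square of the positive part, the penalty for negative coordinates in `link`. -/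
def sqPos (y : ℝ) : ℝ := max y 0 ^ 2

/-- A differentiable gate: zero on `(-∞, 0]` and increasing to `1` at infinity. -/
def gate (y : ℝ) : ℝ := 1 - cauchy (max y 0)

/-- The derivative of `gate`. -/
def gateDeriv (y : ℝ) : ℝ := cauchySlope (max y 0)

/-- A bounded positive function with derivative `cauchy`. -/
def ramp (y : ℝ) : ℝ := Real.arctan y + Real.pi / 2

lemma abs_sub_le_of_abs_deriv_le {f f' : ℝ → ℝ} {C : ℝ} (hf : ∀ x, HasDerivAt f (f' x) x)
    (hC : ∀ x, |f' x| ≤ C) (a b : ℝ) : |f a - f b| ≤ C * |a - b| :=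
  convex_univ.norm_image_sub_le_of_norm_hasDerivWithin_le
    (fun x _ => (hf x).hasDerivWithinAt) (fun x _ => hC x) trivial trivial

lemma cauchy_pos (y : ℝ) : 0 < cauchy y := by
  unfold cauchy
  positivity

lemma cauchy_le_one (y : ℝ) : cauchy y ≤ 1 :=
  inv_le_one_of_one_le₀ (by linarith [sq_nonneg y])

lemma half_le_cauchy {y : ℝ} (hy : |y| ≤ 1) : 1 / 2 ≤ cauchy y := by
  rw [cauchy, one_div]
  exact inv_anti₀ (by positivity) (by linarith [(sq_le_one_iff_abs_le_one y).2 hy])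

lemma cauchy_le_half {y : ℝ} (hy : 1 ≤ y) : cauchy y ≤ 1 / 2 := by
  rw [cauchy, one_div]
  exact inv_anti₀ two_pos (by nlinarith)

lemma abs_cauchySlope_le_one (y : ℝ) : |cauchySlope y| ≤ 1 := by
  have hy : 2 * |y| ≤ 1 + |y| ^ 2 := by nlinarith [sq_nonneg (|y| - 1)]
  rw [cauchySlope, abs_div, abs_mul, abs_two, abs_of_pos (by positivity : 0 < (1 + y ^ 2) ^ 2),
    div_le_one (by positivity), ← sq_abs y]
  nlinarith [sq_nonneg |y|]

lemma hasDerivAt_one_add_sq (y : ℝ) : HasDerivAt (fun z : ℝ => 1 + z ^ 2) (2 * y) y := by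
  simpa using (hasDerivAt_pow 2 y).const_add 1

lemma hasDerivAt_cauchy (y : ℝ) : HasDerivAt cauchy (-cauchySlope y) y := by
  refine ((hasDerivAt_one_add_sq y).inv (by positivity)).congr_deriv ?_
  rw [cauchySlope, neg_div]

lemma hasDerivAt_cauchySlope (y : ℝ) :
    HasDerivAt cauchySlope (2 * (1 - 3 * y ^ 2) / (1 + y ^ 2) ^ 3) y := by
  refine (((hasDerivAt_id y).const_mul 2).div ((hasDerivAt_one_add_sq y).pow 2)
    (pow_ne_zero 2 (by positivity))).congr_deriv ?_
  simp only [id, Pi.pow_apply]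
  field_simp
  ring

lemma abs_cauchy_sub_le (a b : ℝ) : |cauchy a - cauchy b| ≤ |a - b| := by
  simpa using abs_sub_le_of_abs_deriv_le hasDerivAt_cauchy
    (fun y => (abs_neg _).trans_le (abs_cauchySlope_le_one y)) a b

lemma abs_cauchySlope_sub_le (a b : ℝ) : |cauchySlope a - cauchySlope b| ≤ 2 * |a - b| := by
  refine abs_sub_le_of_abs_deriv_le hasDerivAt_cauchySlope (fun y => ?_) a b
  have hy := sq_nonneg y
  rw [abs_div, abs_mul, abs_two, abs_of_pos (by positivity : 0 < (1 + y ^ 2) ^ 3),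
    div_le_iff₀ (by positivity)]
  refine mul_le_mul_of_nonneg_left (abs_le.2 ?_) zero_le_two
  constructor <;> nlinarith [pow_nonneg hy 2, pow_nonneg hy 3]

lemma hasDerivAt_sqPos (y : ℝ) : HasDerivAt sqPos (2 * max y 0) y := by
  rw [hasDerivAt_iff_isLittleO]
  refine Asymptotics.IsBigO.trans_isLittleO (g := fun z : ℝ => ‖z - y‖ ^ 2) ?_
    (Asymptotics.isLittleO_pow_sub_sub y one_lt_two)
  refine Asymptotics.IsBigO.of_bound 1 (Filter.Eventually.of_forall fun z => ?_)
  rw [norm_pow, norm_norm, Real.norm_eq_abs, Real.norm_eq_abs, sq_abs, abs_le]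
  simp only [sqPos, smul_eq_mul]
  rcases max_cases y 0 with ⟨hy, _⟩ | ⟨hy, _⟩ <;> rcases max_cases z 0 with ⟨hz, _⟩ | ⟨hz, _⟩ <;>
    rw [hy, hz] <;> constructor <;> nlinarith [sq_nonneg (z - y)]

lemma gate_nonneg (y : ℝ) : 0 ≤ gate y := sub_nonneg.2 (cauchy_le_one _)

lemma gate_le_one (y : ℝ) : gate y ≤ 1 := sub_le_self _ (cauchy_pos _).le

lemma gate_zero : gate 0 = 0 := by simp [gate, cauchy]

lemma half_le_gate {y : ℝ} (hy : 1 ≤ y) : 1 / 2 ≤ gate y := by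
  have := cauchy_le_half (hy.trans (le_max_left y 0))
  rw [gate]
  linarith

lemma abs_gate_sub_le (a b : ℝ) : |gate a - gate b| ≤ |a - b| := by
  rw [gate, gate, sub_sub_sub_cancel_left, abs_sub_comm]
  exact (abs_cauchy_sub_le _ _).trans (abs_max_sub_max_le_abs _ _ _)

lemma hasDerivAt_gate (y : ℝ) : HasDerivAt gate (gateDeriv y) y := by
  have h := ((hasDerivAt_sqPos y).const_add 1).inv
    (add_pos_of_pos_of_nonneg one_pos (sq_nonneg (max y 0))).ne'
  exact (h.const_sub 1).congr_deriv (by rw [gateDeriv, cauchySlope, sqPos, neg_div, neg_neg])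

lemma gateDeriv_nonneg (y : ℝ) : 0 ≤ gateDeriv y :=
  div_nonneg (mul_nonneg zero_le_two (le_max_right y 0)) (sq_nonneg _)

lemma gateDeriv_le_one (y : ℝ) : gateDeriv y ≤ 1 := (abs_le.1 (abs_cauchySlope_le_one _)).2

lemma gateDeriv_zero : gateDeriv 0 = 0 := by simp [gateDeriv, cauchySlope]

lemma abs_gateDeriv_sub_le (a b : ℝ) : |gateDeriv a - gateDeriv b| ≤ 2 * |a - b| :=
  (abs_cauchySlope_sub_le _ _).trans
    (mul_le_mul_of_nonneg_left (abs_max_sub_max_le_abs _ _ _) zero_le_two)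

lemma ramp_nonneg (y : ℝ) : 0 ≤ ramp y := by
  unfold ramp
  linarith [Real.neg_pi_div_two_lt_arctan y]

lemma ramp_le_four (y : ℝ) : ramp y ≤ 4 := by
  unfold ramp
  linarith [Real.arctan_lt_pi_div_two y, Real.pi_lt_four]

lemma hasDerivAt_ramp (y : ℝ) : HasDerivAt ramp (cauchy y) y :=
  ((Real.hasDerivAt_arctan y).add_const _).congr_deriv (one_div _)

lemma abs_ramp_sub_le (a b : ℝ) : |ramp a - ramp b| ≤ |a - b| := by
  simpa using abs_sub_le_of_abs_deriv_le hasDerivAt_ramp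
    (fun y => (abs_of_pos (cauchy_pos y)).trans_le (cauchy_le_one y)) a b

/-! ### The chain function -/

/-- One link of the chain: it can be decreased by increasing `b`, but at `b = 0` only once
`0 < a`. -/
def link (a b : ℝ) : ℝ := -(gate a * ramp b) + sqPos (-b) / 2

/-- The partial derivative of `link` in its first argument. -/
def linkDerivLeft (a b : ℝ) : ℝ := -(gateDeriv a * ramp b)

/-- The partial derivative of `link` in its second argument. -/
def linkDerivRight (a b : ℝ) : ℝ := -(gate a * cauchy b) - max (-b) 0

lemma linkDerivLeft_zero (b : ℝ) : linkDerivLeft 0 b = 0 := by simp [linkDerivLeft, gateDeriv_zero]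

lemma linkDerivLeft_nonpos (a b : ℝ) : linkDerivLeft a b ≤ 0 :=
  neg_nonpos.2 (mul_nonneg (gateDeriv_nonneg a) (ramp_nonneg b))

lemma linkDerivRight_zero_zero : linkDerivRight 0 0 = 0 := by simp [linkDerivRight, gate_zero]

lemma linkDerivRight_le_neg_quarter {a b : ℝ} (ha : 1 ≤ a) (hb : b < 1) :
    linkDerivRight a b ≤ -(1 / 4) := by
  unfold linkDerivRight
  rcases le_or_gt (-1) b with h | h
  · have := mul_le_mul (half_le_gate ha) (half_le_cauchy (abs_le.2 ⟨h, hb.le⟩)) (by norm_num)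
      (gate_nonneg a)
    linarith [le_max_right (-b) 0]
  · linarith [mul_nonneg (gate_nonneg a) (cauchy_pos b).le, le_max_left (-b) 0]

lemma neg_four_le_link (a b : ℝ) : -4 ≤ link a b := by
  have hgr := mul_le_mul (gate_le_one a) (ramp_le_four b) (ramp_nonneg b) zero_le_one
  have hb : 0 ≤ sqPos (-b) := sq_nonneg _
  unfold link
  linarith

lemma link_zero_right_nonpos (a : ℝ) : link a 0 ≤ 0 := by
  simpa [link, sqPos] using mul_nonneg (gate_nonneg a) (ramp_nonneg 0)

lemma abs_mul_sub_mul_le (a b a' b' : ℝ) :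
    |a * b - a' * b'| ≤ |a - a'| * |b| + |a'| * |b - b'| := by
  rw [← abs_mul, ← abs_mul]
  exact (abs_add_le _ _).trans_eq' (by ring_nf)

lemma abs_linkDerivLeft_sub_le (a b a' b' : ℝ) :
    |linkDerivLeft a b - linkDerivLeft a' b'| ≤ 8 * |a - a'| + |b - b'| := by
  rw [linkDerivLeft, linkDerivLeft, neg_sub_neg, abs_sub_comm]
  refine (abs_mul_sub_mul_le _ _ _ _).trans (add_le_add ?_ ?_)
  · rw [abs_of_nonneg (ramp_nonneg b)]
    calc |gateDeriv a - gateDeriv a'| * ramp b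
        ≤ 2 * |a - a'| * 4 := mul_le_mul (abs_gateDeriv_sub_le a a') (ramp_le_four b)
          (ramp_nonneg b) (by positivity)
      _ = 8 * |a - a'| := by ring
  · rw [abs_of_nonneg (gateDeriv_nonneg a')]
    exact (mul_le_of_le_one_left (abs_nonneg _) (gateDeriv_le_one a')).trans (abs_ramp_sub_le _ _)

lemma abs_linkDerivRight_sub_le (a b a' b' : ℝ) :
    |linkDerivRight a b - linkDerivRight a' b'| ≤ |a - a'| + 2 * |b - b'| := by
  have hgate : |gate a * cauchy b - gate a' * cauchy b'| ≤ |a - a'| + |b - b'| := by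
    refine (abs_mul_sub_mul_le _ _ _ _).trans (add_le_add ?_ ?_)
    · rw [abs_of_pos (cauchy_pos b)]
      exact (mul_le_of_le_one_right (abs_nonneg _) (cauchy_le_one b)).trans (abs_gate_sub_le _ _)
    · rw [abs_of_nonneg (gate_nonneg a')]
      exact (mul_le_of_le_one_left (abs_nonneg _) (gate_le_one a')).trans (abs_cauchy_sub_le _ _)
  have hmax : |max (-b) 0 - max (-b') 0| ≤ |b - b'| := by
    refine (abs_max_sub_max_le_abs _ _ _).trans_eq ?_
    rw [neg_sub_neg, abs_sub_comm]
  calc |linkDerivRight a b - linkDerivRight a' b'|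
      = |-(gate a * cauchy b - gate a' * cauchy b') - (max (-b) 0 - max (-b') 0)| := by
        unfold linkDerivRight
        ring_nf
    _ ≤ |gate a * cauchy b - gate a' * cauchy b'| + |max (-b) 0 - max (-b') 0| :=
        (abs_sub _ _).trans_eq (by rw [abs_neg])
    _ ≤ |a - a'| + 2 * |b - b'| := by linarith

section Chain

variable {d : ℕ}

/-- The coordinates of `x`, preceded by a virtual coordinate `1` and followed by zeros, so that
coordinate `j` of `x` is `paddedCoord x (j + 1)`. -/
def paddedCoord (x : Vec d) : ℕ → ℝ
  | 0 => 1
  | j + 1 => if h : j < d then x ⟨j, h⟩ else 0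

/-- The derivative of `paddedCoord · j`. -/
def paddedCoordDeriv : ℕ → (Vec d →L[ℝ] ℝ)
  | 0 => 0
  | j + 1 => if h : j < d then EuclideanSpace.proj ⟨j, h⟩ else 0

/-- The weighted chain of links between consecutive coordinates. -/
def chain (w : ℕ → ℝ) (x : Vec d) : ℝ :=
  ∑ j ∈ Finset.range (d + 1), w j * link (paddedCoord x j) (paddedCoord x (j + 1))

/-- The gradient of `chain w`. -/
def chainGrad (w : ℕ → ℝ) (x : Vec d) : Vec d :=
  WithLp.toLp 2 fun j : Fin d =>
    w j * linkDerivRight (paddedCoord x j) (paddedCoord x (j + 1)) +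
      w (j + 1) * linkDerivLeft (paddedCoord x (j + 1)) (paddedCoord x (j + 2))

lemma chainGrad_apply (w : ℕ → ℝ) (x : Vec d) (j : Fin d) :
    chainGrad w x j = w j * linkDerivRight (paddedCoord x j) (paddedCoord x (j + 1)) +
      w (j + 1) * linkDerivLeft (paddedCoord x (j + 1)) (paddedCoord x (j + 2)) := rfl

lemma hasFDerivAt_paddedCoord (x : Vec d) (j : ℕ) :
    HasFDerivAt (fun y : Vec d => paddedCoord y j) (paddedCoordDeriv j) x := by
  cases j with
  | zero => exact hasFDerivAt_const _ _
  | succ j =>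
    by_cases h : j < d
    · simp only [paddedCoord, paddedCoordDeriv, h, dif_pos]
      exact (EuclideanSpace.proj (𝕜 := ℝ) (⟨j, h⟩ : Fin d)).hasFDerivAt
    · simp only [paddedCoord, paddedCoordDeriv, h, dif_neg, not_false_eq_true]
      exact hasFDerivAt_const _ _

lemma hasFDerivAt_link_paddedCoord (x : Vec d) (j : ℕ) :
    HasFDerivAt (fun y : Vec d => link (paddedCoord y j) (paddedCoord y (j + 1)))
      (linkDerivLeft (paddedCoord x j) (paddedCoord x (j + 1)) • paddedCoordDeriv j +
        linkDerivRight (paddedCoord x j) (paddedCoord x (j + 1)) • paddedCoordDeriv (j + 1)) x := by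
  have hleft := hasFDerivAt_paddedCoord x j
  have hright := hasFDerivAt_paddedCoord x (j + 1)
  have hgate := (hasDerivAt_gate (paddedCoord x j)).comp_hasFDerivAt x hleft
  have hramp := (hasDerivAt_ramp (paddedCoord x (j + 1))).comp_hasFDerivAt x hright
  have hneg := ((hasDerivAt_sqPos (-paddedCoord x (j + 1))).comp_hasFDerivAt x
    hright.neg).mul_const (1 / 2)
  refine (((hgate.mul hramp).neg.add hneg).congr_fderiv ?_).congr_of_eventuallyEq
    (Filter.Eventually.of_forall fun y => ?_)
  · ext z
    simp only [Function.comp_apply, neg_add_rev, smul_neg, add_apply, neg_apply, smul_apply,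
      smul_eq_mul, linkDerivLeft, linkDerivRight]
    ring
  · simp only [link, Function.comp_apply, Pi.neg_apply, Pi.add_apply, Pi.mul_apply]
    ring

theorem hasGradientAt_chain (w : ℕ → ℝ) (x : Vec d) :
    HasGradientAt (chain w) (chainGrad w x) x := by
  rw [hasGradientAt_iff_hasFDerivAt]
  refine (HasFDerivAt.fun_sum fun j _ =>
    (hasFDerivAt_link_paddedCoord x j).const_mul (w j)).congr_fderiv ?_
  ext z
  have hz (j : Fin d) : paddedCoordDeriv (d := d) (j + 1) z = z j := by simp [paddedCoordDeriv]
  have hlast : paddedCoordDeriv (d := d) (d + 1) z = 0 := by simp [paddedCoordDeriv]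
  have hfirst : paddedCoordDeriv (d := d) 0 z = 0 := rfl
  simp only [sum_apply, smul_apply, add_apply, smul_eq_mul, mul_add, Finset.sum_add_distrib,
    InnerProductSpace.toDual_apply_apply, PiLp.inner_apply]
  rw [Finset.sum_range_succ', Finset.sum_range_succ, hfirst, hlast, mul_zero, mul_zero, mul_zero,
    mul_zero, add_zero, add_zero, ← Finset.sum_add_distrib, Finset.sum_range]
  refine Finset.sum_congr rfl fun j _ => ?_
  rw [hz, chainGrad_apply, RCLike.inner_apply, conj_trivial]
  ring

lemma neg_four_mul_sum_le_chain {w : ℕ → ℝ} (hw : ∀ j, 0 ≤ w j) (x : Vec d) :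
    -(4 * ∑ j ∈ Finset.range (d + 1), w j) ≤ chain w x := by
  rw [← neg_mul, mul_comm, Finset.sum_mul]
  exact Finset.sum_le_sum fun j _ => mul_le_mul_of_nonneg_left (neg_four_le_link _ _) (hw j)

lemma chain_zero_nonpos {w : ℕ → ℝ} (hw : ∀ j, 0 ≤ w j) : chain w (0 : Vec d) ≤ 0 := by
  refine Finset.sum_nonpos fun j _ => mul_nonpos_of_nonneg_of_nonpos (hw j) ?_
  have hj : paddedCoord (0 : Vec d) (j + 1) = 0 := by simp [paddedCoord]
  rw [hj]
  exact link_zero_right_nonpos _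

lemma abs_chainGrad_sub_le {w : ℕ → ℝ} (hw : ∀ j, |w j| ≤ 1) (x y : Vec d) (j : Fin d) :
    |chainGrad w x j - chainGrad w y j| ≤
      |paddedCoord x j - paddedCoord y j| + 10 * |paddedCoord x (j + 1) - paddedCoord y (j + 1)| +
        |paddedCoord x (j + 2) - paddedCoord y (j + 2)| := by
  have hmul (i : ℕ) (r : ℝ) : |w i * r| ≤ |r| := by
    rw [abs_mul]
    exact mul_le_of_le_one_left (abs_nonneg _) (hw i)
  have hright := (hmul j _).trans (abs_linkDerivRight_sub_le (paddedCoord x j)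
    (paddedCoord x (j + 1)) (paddedCoord y j) (paddedCoord y (j + 1)))
  have hleft := (hmul (j + 1) _).trans (abs_linkDerivLeft_sub_le (paddedCoord x (j + 1))
    (paddedCoord x (j + 2)) (paddedCoord y (j + 1)) (paddedCoord y (j + 2)))
  rw [chainGrad_apply, chainGrad_apply, add_sub_add_comm, ← mul_sub, ← mul_sub]
  refine (abs_add_le _ _).trans ?_
  linarith

lemma sum_paddedCoord_sub_sq_le (x y : Vec d) (N : ℕ) :
    ∑ j ∈ Finset.range N, (paddedCoord x j - paddedCoord y j) ^ 2 ≤ ‖x - y‖ ^ 2 := by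
  calc ∑ j ∈ Finset.range N, (paddedCoord x j - paddedCoord y j) ^ 2
      ≤ ∑ j ∈ Finset.range (d + N + 1), (paddedCoord x j - paddedCoord y j) ^ 2 :=
        Finset.sum_le_sum_of_subset_of_nonneg (Finset.range_subset_range.2 (by omega))
          fun _ _ _ => sq_nonneg _
    _ = ∑ j ∈ Finset.range d, (paddedCoord x (j + 1) - paddedCoord y (j + 1)) ^ 2 := by
        rw [Finset.sum_range_succ', Finset.sum_range_add]
        simp [paddedCoord]
    _ = ‖x - y‖ ^ 2 := by
        rw [EuclideanSpace.norm_sq_eq, Finset.sum_range]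
        simp [paddedCoord]

lemma sum_paddedCoord_add_sub_sq_le (x y : Vec d) (c : ℕ) :
    ∑ j : Fin d, (paddedCoord x (j + c) - paddedCoord y (j + c)) ^ 2 ≤ ‖x - y‖ ^ 2 := by
  refine le_trans ?_ (sum_paddedCoord_sub_sq_le x y (c + d))
  rw [Finset.sum_range_add, Finset.sum_range (n := d)]
  simp only [add_comm c]
  exact le_add_of_nonneg_left
    (Finset.sum_nonneg fun j _ => sq_nonneg (paddedCoord x j - paddedCoord y j))

theorem norm_chainGrad_sub_le {w : ℕ → ℝ} (hw : ∀ j, |w j| ≤ 1) (x y : Vec d) :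
    ‖chainGrad w x - chainGrad w y‖ ≤ 18 * ‖x - y‖ := by
  have hcoord (j : Fin d) : ‖(chainGrad w x - chainGrad w y) j‖ ^ 2 ≤
      102 * ((paddedCoord x (j + 0) - paddedCoord y (j + 0)) ^ 2 +
        (paddedCoord x (j + 1) - paddedCoord y (j + 1)) ^ 2 +
        (paddedCoord x (j + 2) - paddedCoord y (j + 2)) ^ 2) := by
    rw [Real.norm_eq_abs, PiLp.sub_apply]
    refine (pow_le_pow_left₀ (abs_nonneg _) (abs_chainGrad_sub_le hw x y j) 2).trans ?_
    simp only [add_zero, ← sq_abs (paddedCoord x _ - paddedCoord y _)]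
    generalize |paddedCoord x j - paddedCoord y j| = a
    generalize |paddedCoord x (j + 1) - paddedCoord y (j + 1)| = b
    generalize |paddedCoord x (j + 2) - paddedCoord y (j + 2)| = c
    nlinarith [sq_nonneg (10 * a - b), sq_nonneg (a - c), sq_nonneg (10 * c - b)]
  refine abs_le_of_sq_le_sq' ?_ (by positivity) |>.2
  rw [EuclideanSpace.norm_sq_eq, mul_pow]
  refine (Finset.sum_le_sum fun j _ => hcoord j).trans ?_
  rw [← Finset.mul_sum, Finset.sum_add_distrib, Finset.sum_add_distrib]
  linarith [sum_paddedCoord_add_sub_sq_le x y 0, sum_paddedCoord_add_sub_sq_le x y 1,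
    sum_paddedCoord_add_sub_sq_le x y 2, sq_nonneg ‖x - y‖]

lemma exists_one_le_paddedCoord_and_lt_one {x : Vec d} {T : ℕ} (hx : paddedCoord x T < 1) :
    ∃ j < T, 1 ≤ paddedCoord x j ∧ paddedCoord x (j + 1) < 1 := by
  induction T with
  | zero => exact absurd hx (lt_irrefl 1)
  | succ T ih =>
    rcases lt_or_ge (paddedCoord x T) 1 with hT | hT
    · obtain ⟨j, hj, h⟩ := ih hT
      exact ⟨j, hj.trans T.lt_succ_self, h⟩
    · exact ⟨T, T.lt_succ_self, hT, hx⟩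

theorem quarter_le_norm_chainGrad {w : ℕ → ℝ} (hw : ∀ j, 0 ≤ w j) {T : ℕ} (hTd : T ≤ d)
    (hT : ∀ j < T, 1 ≤ w j) {x : Vec d} (hx : paddedCoord x T < 1) :
    1 / 4 ≤ ‖chainGrad w x‖ := by
  obtain ⟨j, hjT, hj, hj'⟩ := exists_one_le_paddedCoord_and_lt_one hx
  have hright := linkDerivRight_le_neg_quarter hj hj'
  have hleft := mul_nonpos_of_nonneg_of_nonpos (hw (j + 1))
    (linkDerivLeft_nonpos (paddedCoord x (j + 1)) (paddedCoord x (j + 2)))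
  have hneg : chainGrad w x ⟨j, hjT.trans_le hTd⟩ ≤ -(1 / 4) := by
    rw [chainGrad_apply]
    nlinarith [hT j hjT]
  calc 1 / 4 ≤ -chainGrad w x ⟨j, hjT.trans_le hTd⟩ := by linarith
    _ ≤ ‖chainGrad w x ⟨j, hjT.trans_le hTd⟩‖ := neg_le_abs _
    _ ≤ ‖chainGrad w x‖ := PiLp.norm_apply_le _ _

/-- The chain with gradients of magnitude `a` on the length scale `lam`. -/
def scaledChain (a lam : ℝ) (w : ℕ → ℝ) (x : Vec d) : ℝ :=
  a * lam * chain w (lam⁻¹ • x)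

lemma hasGradientAt_scaledChain (w : ℕ → ℝ) (a : ℝ) {lam : ℝ} (hlam : lam ≠ 0) (x : Vec d) :
    HasGradientAt (scaledChain a lam w) (a • chainGrad w (lam⁻¹ • x)) x := by
  rw [hasGradientAt_iff_hasFDerivAt]
  have hchain := hasGradientAt_iff_hasFDerivAt.1 (hasGradientAt_chain w (lam⁻¹ • x))
  refine ((hchain.comp x ((hasFDerivAt_id x).const_smul lam⁻¹)).const_mul (a * lam)).congr_fderiv ?_
  ext z
  simp [field]

lemma gradient_scaledChain (w : ℕ → ℝ) (a : ℝ) {lam : ℝ} (hlam : lam ≠ 0) (x : Vec d) :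
    gradient (scaledChain a lam w) x = a • chainGrad w (lam⁻¹ • x) :=
  (hasGradientAt_scaledChain w a hlam x).gradient

end Chain

/-! ### Discovered coordinates -/

section Progress

variable {d : ℕ}

/-- The number of leading coordinates outside of which `x` vanishes. -/
def prog (x : Vec d) : ℕ := Finset.univ.sup fun j : Fin d => if x j = 0 then 0 else j + 1

lemma prog_le_iff {x : Vec d} {N : ℕ} : prog x ≤ N ↔ ∀ j : Fin d, N ≤ j → x j = 0 := by
  simp only [prog, Finset.sup_le_iff, Finset.mem_univ, true_imp_iff]
  refine forall_congr' fun j => ?_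
  split_ifs with h <;> simp [h]

lemma apply_eq_zero_of_prog_le {x : Vec d} {j : Fin d} (h : prog x ≤ j) : x j = 0 :=
  prog_le_iff.1 le_rfl j h

lemma paddedCoord_eq_zero_of_prog_lt {x : Vec d} {j : ℕ} (h : prog x < j) :
    paddedCoord x j = 0 := by
  obtain ⟨j, rfl⟩ := Nat.exists_eq_succ_of_ne_zero h.ne_bot
  simp only [paddedCoord]
  split_ifs with hj
  · exact apply_eq_zero_of_prog_le (j := ⟨j, hj⟩) (Nat.lt_succ_iff.1 h)
  · rfl

lemma prog_zero : prog (0 : Vec d) = 0 := Nat.le_zero.1 (prog_le_iff.2 fun _ _ => rfl)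

lemma prog_smul_le (r : ℝ) (x : Vec d) : prog (r • x) ≤ prog x :=
  prog_le_iff.2 fun j hj => by simp [apply_eq_zero_of_prog_le hj]

lemma chainGrad_eq_zero_of_prog_lt (w : ℕ → ℝ) {x : Vec d} {j : Fin d} (h : prog x < j) :
    chainGrad w x j = 0 := by
  rw [chainGrad_apply, paddedCoord_eq_zero_of_prog_lt h,
    paddedCoord_eq_zero_of_prog_lt (h.trans (Nat.lt_succ_self _)), linkDerivRight_zero_zero,
    linkDerivLeft_zero, mul_zero, mul_zero, add_zero]

lemma abs_chainGrad_le_of_prog_le {w : ℕ → ℝ} {x : Vec d} {j : Fin d} (hw : 0 ≤ w j)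
    (h : prog x ≤ j) : |chainGrad w x j| ≤ w j := by
  rw [chainGrad_apply, paddedCoord_eq_zero_of_prog_lt (Nat.lt_succ_iff.2 h), linkDerivLeft_zero,
    mul_zero, add_zero, abs_mul, abs_of_nonneg hw]
  refine mul_le_of_le_one_right hw ?_
  simp only [linkDerivRight, neg_zero, max_self, sub_zero, abs_neg]
  rw [abs_of_nonneg (mul_nonneg (gate_nonneg _) (cauchy_pos 0).le)]
  exact mul_le_one₀ (gate_le_one _) (cauchy_pos 0).le (cauchy_le_one 0)

end Progress

/-! ### Independent draws and adaptive hits -/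

section Draws

open MeasureTheory ProbabilityTheory

variable {Ξ : Type}

open Classical in
/-- The number of draws among the first `k` that hit their target, when the target `S j ξ` of
draw `j` may be chosen according to the sequence `ξ`. -/
def hitCount (S : ℕ → (ℕ → Ξ) → Set Ξ) (ξ : ℕ → Ξ) (k : ℕ) : ℕ :=
  Nat.count (fun j => ξ j ∈ S j ξ) k

lemma hitCount_succ_of_mem {S : ℕ → (ℕ → Ξ) → Set Ξ} {ξ : ℕ → Ξ} {k : ℕ} (h : ξ k ∈ S k ξ) :
    hitCount S ξ (k + 1) = hitCount S ξ k + 1 := by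
  simp [hitCount, Nat.count_succ, h]

lemma hitCount_monotone (S : ℕ → (ℕ → Ξ) → Set Ξ) (ξ : ℕ → Ξ) : Monotone (hitCount S ξ) := by
  classical exact Nat.count_monotone _

lemma dependsOn_hitCount {S : ℕ → (ℕ → Ξ) → Set Ξ} (hS : ∀ k, DependsOn (S k) (Set.Iio k))
    (k : ℕ) : DependsOn (fun ξ => hitCount S ξ k) (Set.Iio k) := fun ξ ξ' h => by
  classical
  simp only [hitCount, Nat.count_eq_card_filter_range]
  refine congrArg Finset.card (Finset.filter_congr fun j hj => ?_)
  have hj := Finset.mem_range.1 hj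
  rw [hS j fun l hl => h l (Set.mem_Iio.2 (hl.trans hj)), h j hj]

open Classical in
lemma two_pow_hitCount (S : ℕ → (ℕ → Ξ) → Set Ξ) (ξ : ℕ → Ξ) (k : ℕ) :
    (2 : ℝ≥0∞) ^ hitCount S ξ k = ∏ j ∈ Finset.range k, if ξ j ∈ S j ξ then 2 else 1 := by
  rw [hitCount, Nat.count_eq_card_filter_range, ← Finset.prod_const, Finset.prod_filter]

variable [MeasurableSpace Ξ]

open Classical in
/-- The factor by which draw `k` changes the supermartingale
`2 ^ hitCount S ξ k * exp (-∑ j < k, D (S j ξ))`. -/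
def hitFactor (D : Measure Ξ) (S : ℕ → (ℕ → Ξ) → Set Ξ) (k : ℕ) (ξ : ℕ → Ξ) (y : Ξ) :
    ℝ≥0∞ :=
  ENNReal.ofReal (Real.exp (-D.real (S k ξ))) * if y ∈ S k ξ then 2 else 1

lemma two_pow_hitCount_le (D : Measure Ξ) (S : ℕ → (ℕ → Ξ) → Set Ξ) {B : ℝ} {ξ : ℕ → Ξ}
    {k : ℕ} (hB : ∑ j ∈ Finset.range k, D.real (S j ξ) ≤ B) :
    (2 : ℝ≥0∞) ^ hitCount S ξ k ≤
      ENNReal.ofReal (Real.exp B) * ∏ j ∈ Finset.range k, hitFactor D S j ξ (ξ j) := by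
  simp only [hitFactor]
  rw [Finset.prod_mul_distrib, ← two_pow_hitCount,
    ← ENNReal.ofReal_prod_of_nonneg fun _ _ => (Real.exp_pos _).le, ← Real.exp_sum,
    Finset.sum_neg_distrib, ← mul_assoc, ← ENNReal.ofReal_mul (Real.exp_pos _).le, ← Real.exp_add]
  exact le_mul_of_one_le_left' (ENNReal.one_le_ofReal.2 (Real.one_le_exp (by linarith)))

/-- The law of a sequence of independent draws with law `D`. -/
abbrev draws (D : Measure Ξ) [IsProbabilityMeasure D] : Measure (ℕ → Ξ) :=
  Measure.infinitePi fun _ : ℕ => D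

lemma indepFun_domRestrict_Iio_eval (D : Measure Ξ) [IsProbabilityMeasure D] (k : ℕ) :
    IndepFun (Set.Iio k).domRestrict (fun ξ : ℕ → Ξ => ξ k) (draws D) := by
  have hind : iIndepFun (fun (j : ℕ) (ξ : ℕ → Ξ) => ξ j) (draws D) :=
    iIndepFun_infinitePi (X := fun _ (y : Ξ) => y) fun _ => measurable_id
  have hpair := hind.indepFun_finset (Finset.range k) {k} (by simp) fun j => measurable_pi_apply j
  have hlast : Measurable fun y : ({k} : Finset ℕ) → Ξ => y ⟨k, Finset.mem_singleton_self k⟩ :=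
    measurable_pi_apply _
  exact hpair.comp (φ := fun y (j : Set.Iio k) => y ⟨j, Finset.mem_range.2 j.2⟩) (by fun_prop)
    hlast

variable [Countable Ξ] [MeasurableSingletonClass Ξ]

lemma measurable_of_dependsOn_Iio {β : Type*} [MeasurableSpace β] [Nonempty β] {k : ℕ}
    {F : (ℕ → Ξ) → β} (hF : DependsOn F (Set.Iio k)) : Measurable F := by
  obtain ⟨G, rfl⟩ := dependsOn_iff_exists_comp.1 hF
  exact (measurable_of_countable G).comp (measurable_pi_lambda _ fun _ => measurable_pi_apply _)

variable (D : Measure Ξ) [IsProbabilityMeasure D]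

lemma lintegral_draws_eval {k : ℕ} {R : (ℕ → Ξ) → Ξ → ℝ≥0∞} (hR : DependsOn R (Set.Iio k)) :
    ∫⁻ ξ, R ξ (ξ k) ∂draws D = ∫⁻ ξ, ∫⁻ y, R ξ y ∂D ∂draws D := by
  obtain ⟨G, rfl⟩ := dependsOn_iff_exists_comp.1 hR
  have hpast : Measurable ((Set.Iio k).domRestrict (π := fun _ => Ξ)) :=
    measurable_pi_lambda _ fun _ => measurable_pi_apply _
  have hpresent : Measurable fun ξ : ℕ → Ξ => ξ k := measurable_pi_apply k
  have hG : Measurable (Function.uncurry G) := measurable_of_countable _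
  have hprod := (indepFun_iff_map_prod_eq_prod_map_map hpast.aemeasurable
    hpresent.aemeasurable).1 (indepFun_domRestrict_Iio_eval D k)
  have hD : (draws D).map (fun ξ : ℕ → Ξ => ξ k) = D := Measure.infinitePi_map_eval _ k
  rw [hD] at hprod
  calc ∫⁻ ξ, G ((Set.Iio k).domRestrict ξ) (ξ k) ∂draws D
      = ∫⁻ z, Function.uncurry G z
          ∂((draws D).map fun ξ => ((Set.Iio k).domRestrict ξ, ξ k)) :=
        (lintegral_map hG (hpast.prodMk hpresent)).symm
    _ = ∫⁻ x, ∫⁻ y, G x y ∂D ∂((draws D).map (Set.Iio k).domRestrict) := by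
        rw [hprod, lintegral_prod _ hG.aemeasurable]
        rfl
    _ = _ := lintegral_map (measurable_of_countable _) hpast

lemma lintegral_prod_adaptive_le_one {R : ℕ → (ℕ → Ξ) → Ξ → ℝ≥0∞}
    (hR : ∀ k, DependsOn (R k) (Set.Iio k)) (hR1 : ∀ k ξ, ∫⁻ y, R k ξ y ∂D ≤ 1) (k : ℕ) :
    ∫⁻ ξ, ∏ j ∈ Finset.range k, R j ξ (ξ j) ∂draws D ≤ 1 := by
  induction k with
  | zero => simp
  | succ k ih =>
    have hdep : DependsOn (fun (ξ : ℕ → Ξ) (y : Ξ) =>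
        (∏ j ∈ Finset.range k, R j ξ (ξ j)) * R k ξ y) (Set.Iio k) := fun ξ ξ' h => by
      have hpast : ∏ j ∈ Finset.range k, R j ξ (ξ j) = ∏ j ∈ Finset.range k, R j ξ' (ξ' j) :=
        Finset.prod_congr rfl fun j hj => by
          have hj := Finset.mem_range.1 hj
          rw [hR j fun l hl => h l (Set.mem_Iio.2 (hl.trans hj)), h j hj]
      simp only [hpast, hR k h]
    simp only [Finset.prod_range_succ]
    rw [lintegral_draws_eval D hdep]
    refine le_trans (lintegral_mono fun ξ => ?_) ih
    rw [lintegral_const_mul _ (measurable_of_countable _)]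
    exact mul_le_of_le_one_right' (hR1 k ξ)

lemma lintegral_hitFactor_le_one (S : ℕ → (ℕ → Ξ) → Set Ξ) (k : ℕ) (ξ : ℕ → Ξ) :
    ∫⁻ y, hitFactor D S k ξ y ∂D ≤ 1 := by
  classical
  have hsplit (y : Ξ) : (if y ∈ S k ξ then (2 : ℝ≥0∞) else 1) = 1 + (S k ξ).indicator 1 y := by
    by_cases hy : y ∈ S k ξ <;> simp [hy, one_add_one_eq_two]
  simp only [hitFactor, hsplit]
  rw [lintegral_const_mul _ (measurable_of_countable _), lintegral_add_left measurable_const,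
    lintegral_indicator_one (Set.to_countable _).measurableSet, lintegral_one, measure_univ,
    ← ofReal_measureReal, ← ENNReal.ofReal_one,
    ← ENNReal.ofReal_add zero_le_one measureReal_nonneg,
    ← ENNReal.ofReal_mul (Real.exp_pos _).le]
  refine ENNReal.ofReal_le_ofReal ?_
  calc Real.exp (-D.real (S k ξ)) * (1 + D.real (S k ξ))
      ≤ Real.exp (-D.real (S k ξ)) * Real.exp (D.real (S k ξ)) := by
        gcongr
        linarith [Real.add_one_le_exp (D.real (S k ξ))]
    _ = 1 := by rw [← Real.exp_add, neg_add_cancel, Real.exp_zero]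

theorem measure_exists_le_hitCount_le {S : ℕ → (ℕ → Ξ) → Set Ξ}
    (hS : ∀ k, DependsOn (S k) (Set.Iio k)) {B : ℝ}
    (hB : ∀ ξ k, ∑ j ∈ Finset.range k, D.real (S j ξ) ≤ B) (m : ℕ) :
    draws D {ξ | ∃ k, m ≤ hitCount S ξ k} ≤ ENNReal.ofReal (Real.exp B) / 2 ^ m := by
  have hfactor (k : ℕ) : DependsOn (hitFactor D S k) (Set.Iio k) := fun ξ ξ' h => by
    funext y
    rw [hitFactor, hitFactor, hS k h]
  have hmono : Monotone fun k => {ξ | m ≤ hitCount S ξ k} :=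
    fun k l hkl ξ hξ => le_trans hξ (hitCount_monotone S ξ hkl)
  rw [Set.ofPred_exists, hmono.measure_iUnion]
  refine iSup_le fun k => ?_
  rw [ENNReal.le_div_iff_mul_le (by simp) (by simp), mul_comm]
  calc 2 ^ m * draws D {ξ | m ≤ hitCount S ξ k}
      ≤ 2 ^ m * draws D {ξ | (2 : ℝ≥0∞) ^ m ≤ 2 ^ hitCount S ξ k} :=
        mul_le_mul_right (measure_mono (Set.ofPred_subset_ofPred.2 fun _ =>
          pow_le_pow_right₀ one_le_two)) _
    _ ≤ ∫⁻ ξ, 2 ^ hitCount S ξ k ∂draws D :=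
        mul_meas_ge_le_lintegral ((measurable_of_countable fun N : ℕ => (2 : ℝ≥0∞) ^ N).comp
          (measurable_of_dependsOn_Iio (dependsOn_hitCount hS k))) _
    _ ≤ ∫⁻ ξ, ENNReal.ofReal (Real.exp B) * ∏ j ∈ Finset.range k, hitFactor D S j ξ (ξ j)
          ∂draws D := lintegral_mono fun ξ => two_pow_hitCount_le D S (hB ξ k)
    _ = ENNReal.ofReal (Real.exp B) *
          ∫⁻ ξ, ∏ j ∈ Finset.range k, hitFactor D S j ξ (ξ j) ∂draws D :=
        lintegral_const_mul' _ _ ENNReal.ofReal_ne_top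
    _ ≤ ENNReal.ofReal (Real.exp B) := mul_le_of_le_one_right'
        (lintegral_prod_adaptive_le_one D hfactor (lintegral_hitFactor_le_one D S) k)

lemma ofReal_exp_quarter_div_two_pow_le (m : ℕ) :
    ENNReal.ofReal (Real.exp (m / 4)) / 2 ^ m ≤ ENNReal.ofReal (Real.exp (-(m / 4))) := by
  have htwo : Real.exp (m / 2) ≤ 2 ^ m := by
    rw [← Real.exp_log (by positivity : (0 : ℝ) < 2 ^ m), Real.exp_le_exp, Real.log_pow]
    nlinarith [Real.log_two_gt_d9, (Nat.cast_nonneg m : (0 : ℝ) ≤ m)]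
  rw [← ENNReal.ofReal_ofNat 2, ← ENNReal.ofReal_pow zero_le_two,
    ← ENNReal.ofReal_div_of_pos (by positivity)]
  refine ENNReal.ofReal_le_ofReal ((div_le_iff₀ (by positivity)).2 ?_)
  calc Real.exp (m / 4) = Real.exp (-(m / 4)) * Real.exp (m / 2) := by
        rw [← Real.exp_add]
        ring_nf
    _ ≤ Real.exp (-(m / 4)) * 2 ^ m := by gcongr

end Draws

/-! ### The work function -/

lemma work_mono (v : ℝ → ℝ) : Monotone (work v) := fun _ _ h =>
  MeasureTheory.lintegral_mono_set fun _ hτ => ⟨hτ.1, hτ.2.trans h⟩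

lemma work_zero (v : ℝ → ℝ) : work v 0 = 0 := by
  have hset : {τ : ℝ | 0 ≤ τ ∧ ENNReal.ofReal τ ≤ 0} = {0} := by
    ext τ
    simp only [Set.mem_ofPred_eq, nonpos_iff_eq_zero, ENNReal.ofReal_eq_zero, Set.mem_singleton_iff]
    exact ⟨fun h => le_antisymm h.2 h.1, fun h => ⟨h.ge, h.le⟩⟩
  rw [work, hset]
  simp

lemma work_ne_top {v : ℝ → ℝ} (hv : ∀ T : ℝ, MeasureTheory.IntegrableOn v (Set.Icc 0 T))
    {t : ℝ≥0∞} (ht : t ≠ ⊤) : work v t ≠ ⊤ := by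
  have hsub : {τ : ℝ | 0 ≤ τ ∧ ENNReal.ofReal τ ≤ t} ⊆ Set.Icc 0 t.toReal := fun τ hτ =>
    ⟨hτ.1, (ENNReal.ofReal_le_iff_le_toReal ht).1 hτ.2⟩
  exact ((MeasureTheory.lintegral_mono_set hsub).trans_lt (hv t.toReal).lintegral_lt_top).ne

/-! ### Progress in the protocol -/

section Protocol

variable {n d : ℕ} {Ξ : Type} (v : Fin n → ℝ → ℝ) (g : Fin n → Vec d → Ξ → ℝ≥0 → Vec d)
  (A : Algorithm n d) (ξ : ℕ → Ξ)

/-- The worker `i^{k+1}` called in iteration `k`. -/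
def callee (k : ℕ) : Fin n := (A k (run v g A ξ k).2).worker

/-- The state of the called worker before iteration `k`. -/
def calleeState (k : ℕ) : OracleState d := (run v g A ξ k).1 (callee v g A ξ k)

/-- The call in iteration `k` returns a stochastic gradient. -/
def Completes (k : ℕ) : Prop :=
  (A k (run v g A ξ k).2).control = false ∧ (calleeState v g A ξ k).busy = true ∧
    1 ≤ work (v (callee v g A ξ k)) (time v g A ξ (k + 1)) -
      work (v (callee v g A ξ k)) (calleeState v g A ξ k).time

/-- The new state and the vector `g^{k+1}` returned by the oracle call in iteration `k`. -/
def outcome (k : ℕ) : OracleState d × Vec d :=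
  oracle (v (callee v g A ξ k)) (g (callee v g A ξ k)) (time v g A ξ (k + 1))
    (iterate v g A ξ k) (calleeState v g A ξ k) (A k (run v g A ξ k).2).control (ξ k)

lemma run_succ_fst (k : ℕ) : (run v g A ξ (k + 1)).1 =
    Function.update (run v g A ξ k).1 (callee v g A ξ k) (outcome v g A ξ k).1 := rfl

lemma run_succ_snd (k : ℕ) : (run v g A ξ (k + 1)).2 =
    Fin.snoc (run v g A ξ k).2 (outcome v g A ξ k).2 := rfl

variable {v g A ξ} in
lemma outcome_of_completes {k : ℕ} (h : Completes v g A ξ k) :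
    outcome v g A ξ k = (OracleState.idle d, g (callee v g A ξ k) (calleeState v g A ξ k).point
      (ξ k) (time v g A ξ (k + 1))) := by
  obtain ⟨hcontrol, hbusy, hwork⟩ := h
  simp [outcome, oracle, hcontrol, hbusy, not_lt.2 hwork]

variable {v g A ξ} in
lemma outcome_snd_of_not_completes {k : ℕ} (h : ¬ Completes v g A ξ k) :
    (outcome v g A ξ k).2 = 0 := by
  unfold outcome oracle
  split_ifs with hcontrol hbusy hwork
  · rfl
  · rfl
  · rfl
  · exact absurd ⟨by simpa using hcontrol, by simpa using hbusy, not_lt.1 hwork⟩ h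

lemma outcome_fst_eq (k : ℕ) :
    (outcome v g A ξ k).1 = calleeState v g A ξ k ∨ (outcome v g A ξ k).1 = OracleState.idle d ∨
      (outcome v g A ξ k).1 = ⟨time v g A ξ (k + 1), iterate v g A ξ k, true⟩ := by
  unfold outcome oracle
  split_ifs <;> simp

lemma state_succ_eq (i : Fin n) (k : ℕ) :
    (run v g A ξ (k + 1)).1 i = (run v g A ξ k).1 i ∨
      (run v g A ξ (k + 1)).1 i = OracleState.idle d ∨
      (run v g A ξ (k + 1)).1 i = ⟨time v g A ξ (k + 1), iterate v g A ξ k, true⟩ := by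
  rw [run_succ_fst]
  rcases eq_or_ne i (callee v g A ξ k) with rfl | hi
  · rw [Function.update_self]
    exact outcome_fst_eq v g A ξ k
  · exact Or.inl (Function.update_of_ne hi _ _)

variable {A} in
lemma time_mono (hA : IsZeroRespecting A) : Monotone (time v g A ξ) := by
  refine monotone_nat_of_le_succ fun k => ?_
  cases k with
  | zero => exact zero_le
  | succ k => simpa [time, run_succ_snd] using hA.time_mono k (run v g A ξ (k + 1)).2

/-- The number of leading coordinates outside of which `g^1, …, g^k` vanish. -/
def discovered (k : ℕ) : ℕ := Finset.univ.sup fun j : Fin k => prog ((run v g A ξ k).2 j)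

lemma discovered_succ (k : ℕ) : discovered v g A ξ (k + 1) =
    max (discovered v g A ξ k) (prog (outcome v g A ξ k).2) := by
  refine eq_of_forall_ge_iff fun N => ?_
  simp only [discovered, Finset.sup_le_iff, Finset.mem_univ, true_imp_iff, max_le_iff,
    run_succ_snd, Fin.forall_fin_succ', Fin.snoc_castSucc, Fin.snoc_last]

variable {A} in
lemma prog_iterate_le (hA : IsZeroRespecting A) (k : ℕ) :
    prog (iterate v g A ξ k) ≤ discovered v g A ξ k := by
  refine prog_le_iff.2 fun l hl => ?_
  by_contra h
  obtain ⟨j, hj⟩ := hA.supp_subset k _ l h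
  refine hj (apply_eq_zero_of_prog_le (le_trans ?_ hl))
  exact Finset.le_sup (f := fun j : Fin k => prog ((run v g A ξ k).2 j)) (Finset.mem_univ j)

variable {A} in
lemma prog_state_le (hA : IsZeroRespecting A) (k : ℕ) (i : Fin n) :
    prog ((run v g A ξ k).1 i).point ≤ discovered v g A ξ k := by
  induction k with
  | zero => exact prog_zero.le
  | succ k ih =>
    have hmono : discovered v g A ξ k ≤ discovered v g A ξ (k + 1) := by
      rw [discovered_succ]
      exact le_max_left _ _
    refine le_trans ?_ hmono
    rcases state_succ_eq v g A ξ i k with h | h | h <;> rw [h]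
    · exact ih
    · exact prog_zero.le.trans (Nat.zero_le _)
    · exact prog_iterate_le v g ξ hA k

/-- A stochastic gradient at a point with `N` discovered coordinates discovers at most one more,
and none unless coin `N` of the worker shows heads. -/
def GatedBy (coin : Fin n → ℕ → Ξ → Bool) : Prop :=
  ∀ (i : Fin n) (x : Vec d) (y : Ξ) (t : ℝ≥0) (N : ℕ), prog x ≤ N →
    prog (g i x y t) ≤ N + 1 ∧ (coin i N y = false → prog (g i x y t) ≤ N)

variable {v g A ξ}

lemma discovered_succ_of_not_completes {k : ℕ} (h : ¬ Completes v g A ξ k) :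
    discovered v g A ξ (k + 1) = discovered v g A ξ k := by
  rw [discovered_succ, outcome_snd_of_not_completes h, prog_zero, Nat.max_zero]

lemma discovered_succ_le (hA : IsZeroRespecting A) {coin : Fin n → ℕ → Ξ → Bool}
    (hg : GatedBy g coin) (k : ℕ) : discovered v g A ξ (k + 1) ≤ discovered v g A ξ k + 1 := by
  by_cases hc : Completes v g A ξ k
  · rw [discovered_succ, outcome_of_completes hc]
    exact max_le (Nat.le_succ _) (hg _ _ _ _ _ (prog_state_le v g ξ hA k _)).1
  · exact (discovered_succ_of_not_completes hc).trans_le (Nat.le_succ _)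

lemma discovered_succ_le_of_coin_eq_false (hA : IsZeroRespecting A) {coin : Fin n → ℕ → Ξ → Bool}
    (hg : GatedBy g coin) {k : ℕ}
    (h : coin (callee v g A ξ k) (discovered v g A ξ k) (ξ k) = false) :
    discovered v g A ξ (k + 1) ≤ discovered v g A ξ k := by
  by_cases hc : Completes v g A ξ k
  · rw [discovered_succ, outcome_of_completes hc]
    exact max_le le_rfl ((hg _ _ _ _ _ (prog_state_le v g ξ hA k _)).2 h)
  · exact (discovered_succ_of_not_completes hc).le

lemma discovered_eq_zero_of_time_eq_zero (hA : IsZeroRespecting A) {k : ℕ}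
    (h : time v g A ξ k = 0) : discovered v g A ξ k = 0 := by
  induction k with
  | zero => rfl
  | succ k ih =>
    have hk : time v g A ξ k = 0 :=
      le_antisymm ((time_mono v g ξ hA (Nat.le_succ k)).trans h.le) zero_le
    have hc : ¬ Completes v g A ξ k := fun hc => by
      simpa [h, work_zero] using hc.2.2
    rw [discovered_succ_of_not_completes hc, ih hk]

/-! ### Stochastic gradients returned in a time window -/

variable (v g A ξ)

/-- The call in iteration `k` returns a stochastic gradient in the time window `(s, u]`. -/
def CompletesIn (s u : ℝ≥0∞) (k : ℕ) : Prop :=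
  Completes v g A ξ k ∧ s < time v g A ξ (k + 1) ∧ (time v g A ξ (k + 1) : ℝ≥0∞) ≤ u

open Classical in
/-- The number of stochastic gradients of worker `i` in the window `(s, u]`. -/
def callCount (s u : ℝ≥0∞) (i : Fin n) (k : ℕ) : ℕ :=
  Nat.count (fun j => CompletesIn v g A ξ s u j ∧ callee v g A ξ j = i) k

/-- The draws for which the call in iteration `k` returns a stochastic gradient in the window
`(s, u]` whose coin shows heads. -/
def headSet (coin : Fin n → Ξ → Bool) (s u : ℝ≥0∞) (k : ℕ) (ξ : ℕ → Ξ) : Set Ξ :=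
  {y | CompletesIn v g A ξ s u k ∧ coin (callee v g A ξ k) y = true}

/-- The number of stochastic gradients in the window `(s, u]` whose coin shows heads. -/
def headCount (coin : Fin n → Ξ → Bool) (s u : ℝ≥0∞) (k : ℕ) : ℕ :=
  hitCount (headSet v g A coin s u) ξ k

/-- The time since which worker `i` has been computing its next stochastic gradient, or the
current time if it is idle. -/
def startTime (i : Fin n) (k : ℕ) : ℝ≥0 :=
  if ((run v g A ξ k).1 i).busy = true then ((run v g A ξ k).1 i).time else time v g A ξ k

lemma startTime_succ_eq (i : Fin n) (k : ℕ) :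
    startTime v g A ξ i (k + 1) = startTime v g A ξ i k ∨
      startTime v g A ξ i (k + 1) = time v g A ξ (k + 1) := by
  unfold startTime
  rcases state_succ_eq v g A ξ i k with h | h | h <;> rw [h]
  · split_ifs <;> simp
  · simp [OracleState.idle]
  · simp

variable {v g A ξ}

lemma startTime_le_time (hA : IsZeroRespecting A) (i : Fin n) (k : ℕ) :
    startTime v g A ξ i k ≤ time v g A ξ k := by
  induction k with
  | zero => simp [startTime, run, OracleState.idle]
  | succ k ih =>
    rcases startTime_succ_eq v g A ξ i k with h | h <;> rw [h]
    exact ih.trans (time_mono v g ξ hA (Nat.le_succ k))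

lemma startTime_mono (hA : IsZeroRespecting A) (i : Fin n) : Monotone (startTime v g A ξ i) := by
  refine monotone_nat_of_le_succ fun k => ?_
  rcases startTime_succ_eq v g A ξ i k with h | h <;> rw [h]
  exact (startTime_le_time hA i k).trans (time_mono v g ξ hA (Nat.le_succ k))

lemma startTime_callee_succ_of_completes {k : ℕ} (hc : Completes v g A ξ k) :
    startTime v g A ξ (callee v g A ξ k) (k + 1) = time v g A ξ (k + 1) := by
  rw [startTime, run_succ_fst, Function.update_self, outcome_of_completes hc]
  simp [OracleState.idle]

lemma work_startTime_add_one_le {k : ℕ} (hc : Completes v g A ξ k) :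
    work (v (callee v g A ξ k)) (startTime v g A ξ (callee v g A ξ k) k) + 1 ≤
      work (v (callee v g A ξ k)) (time v g A ξ (k + 1)) := by
  have hstart : startTime v g A ξ (callee v g A ξ k) k = (calleeState v g A ξ k).time :=
    if_pos hc.2.1
  rw [hstart]
  have hle : work (v (callee v g A ξ k)) (calleeState v g A ξ k).time ≤
      work (v (callee v g A ξ k)) (time v g A ξ (k + 1)) :=
    (tsub_pos_iff_lt.1 (one_pos.trans_le hc.2.2)).le
  calc work (v (callee v g A ξ k)) (calleeState v g A ξ k).time + 1
      ≤ work (v (callee v g A ξ k)) (calleeState v g A ξ k).time +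
        (work (v (callee v g A ξ k)) (time v g A ξ (k + 1)) -
          work (v (callee v g A ξ k)) (calleeState v g A ξ k).time) := by
        gcongr
        exact hc.2.2
    _ = work (v (callee v g A ξ k)) (time v g A ξ (k + 1)) := add_tsub_cancel_of_le hle

/-- Each returned gradient advances `startTime` by a unit of work, except that the first gradient
of the window may have been started before `s`. -/
lemma callCount_eq_zero_or_add_work_le (hA : IsZeroRespecting A) (s u : ℝ≥0∞) (i : Fin n) (k : ℕ) :
    callCount v g A ξ s u i k = 0 ∨ s ≤ startTime v g A ξ i k ∧
      (callCount v g A ξ s u i k : ℝ≥0∞) + work (v i) s ≤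
        1 + work (v i) (min (startTime v g A ξ i k : ℝ≥0∞) u) := by
  classical
  induction k with
  | zero => exact Or.inl rfl
  | succ k ih =>
    have hstart : (startTime v g A ξ i k : ℝ≥0∞) ≤ startTime v g A ξ i (k + 1) :=
      ENNReal.coe_le_coe.2 (startTime_mono hA i (Nat.le_succ k))
    by_cases h : CompletesIn v g A ξ s u k ∧ callee v g A ξ k = i
    · have hcount : callCount v g A ξ s u i (k + 1) = callCount v g A ξ s u i k + 1 := by
        simp [callCount, Nat.count_succ, h]
      obtain ⟨⟨hc, hs, hu⟩, rfl⟩ := h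
      rw [hcount, startTime_callee_succ_of_completes hc, min_eq_left hu, Nat.cast_succ,
        add_right_comm, add_comm (1 : ℝ≥0∞)]
      refine Or.inr ⟨hs.le, ?_⟩
      gcongr
      rcases ih with h0 | ⟨-, hwork⟩
      · rw [h0, Nat.cast_zero, zero_add]
        exact work_mono _ hs.le
      · refine (hwork.trans ?_).trans (work_startTime_add_one_le hc)
        rw [add_comm]
        gcongr
        exact work_mono _ (min_le_left _ _)
    · have hcount : callCount v g A ξ s u i (k + 1) = callCount v g A ξ s u i k := by
        simp [callCount, Nat.count_succ, h]
      rw [hcount]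
      refine ih.imp_right fun ⟨hs, hwork⟩ => ⟨hs.trans hstart, hwork.trans ?_⟩
      gcongr
      exact work_mono _ (min_le_min_right u hstart)

theorem callCount_le (hA : IsZeroRespecting A) {i : Fin n}
    (hfin : ∀ t ≠ ⊤, work (v i) t ≠ ⊤) (s u : ℝ≥0∞) (k : ℕ) :
    (callCount v g A ξ s u i k : ℝ≥0∞) ≤ 1 + (work (v i) u - work (v i) s) := by
  rcases callCount_eq_zero_or_add_work_le (v := v) (g := g) (ξ := ξ) hA s u i k with
    h | ⟨hs, hwork⟩
  · simp [h]
  · have hs : work (v i) s ≠ ⊤ := hfin s (hs.trans_lt ENNReal.coe_lt_top).ne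
    refine (ENNReal.le_sub_of_add_le_right hs (hwork.trans ?_)).trans add_tsub_le_assoc
    gcongr
    exact work_mono _ (min_le_right _ _)

section Windows

variable {coin : Fin n → ℕ → Ξ → Bool} {m : ℕ}

lemma discovered_le_add_headCount (hA : IsZeroRespecting A)
    (hg : GatedBy g fun i N => coin i (N / m)) {b : ℕ} {s u : ℝ≥0∞}
    (hs : ∀ k, (time v g A ξ k : ℝ≥0∞) ≤ s → discovered v g A ξ k ≤ b * m)
    (hheads : ∀ k, headCount v g A ξ (coin · b) s u k < m) (k : ℕ)
    (hk : (time v g A ξ k : ℝ≥0∞) ≤ u) :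
    discovered v g A ξ k ≤ b * m + headCount v g A ξ (coin · b) s u k := by
  induction k with
  | zero => exact Nat.zero_le _
  | succ k ih =>
    have ih := ih ((ENNReal.coe_le_coe.2 (time_mono v g ξ hA (Nat.le_succ k))).trans hk)
    have hmono : headCount v g A ξ (coin · b) s u k ≤ headCount v g A ξ (coin · b) s u (k + 1) :=
      hitCount_monotone _ ξ (Nat.le_succ k)
    have hstep := discovered_succ_le (v := v) (ξ := ξ) hA hg k
    rcases le_or_gt (time v g A ξ (k + 1) : ℝ≥0∞) s with ht | ht
    · exact (hs (k + 1) ht).trans (Nat.le_add_right _ _)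
    rcases lt_or_ge (discovered v g A ξ k) (b * m) with hlt | hge
    · omega
    by_cases hc : Completes v g A ξ k
    · cases hcoin : coin (callee v g A ξ k) b (ξ k) with
      | true =>
        have : headCount v g A ξ (coin · b) s u (k + 1) =
            headCount v g A ξ (coin · b) s u k + 1 :=
          hitCount_succ_of_mem ⟨⟨hc, ht, hk⟩, hcoin⟩
        omega
      | false =>
        have hdiv : discovered v g A ξ k / m = b :=
          Nat.div_eq_of_lt_le hge (by linarith [hheads k])
        have := discovered_succ_le_of_coin_eq_false hA hg (k := k) (by rwa [hdiv])
        omega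
    · rw [discovered_succ_of_not_completes hc]
      omega

theorem discovered_le (hA : IsZeroRespecting A) (hg : GatedBy g fun i N => coin i (N / m))
    {T : ℕ → ℝ≥0∞} (hT : T 0 = 0) {b : ℕ}
    (hheads : ∀ c < b, ∀ k, headCount v g A ξ (coin · c) (T c) (T (c + 1)) k < m) {k : ℕ}
    (hk : (time v g A ξ k : ℝ≥0∞) ≤ T b) : discovered v g A ξ k ≤ b * m := by
  induction b generalizing k with
  | zero =>
    rw [hT, nonpos_iff_eq_zero, ENNReal.coe_eq_zero] at hk
    rw [discovered_eq_zero_of_time_eq_zero hA hk]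
    exact Nat.zero_le _
  | succ b ih =>
    have hb := hheads b b.lt_succ_self
    have hdisc := discovered_le_add_headCount hA hg
      (fun k => ih fun c hc => hheads c (hc.trans b.lt_succ_self)) hb k hk
    linarith [hb k]

end Windows

/-! ### The number of heads in a time window -/

section Heads

open MeasureTheory

variable (v g A)

lemma dependsOn_run (k : ℕ) : DependsOn (fun ξ => run v g A ξ k) (Set.Iio k) := by
  induction k with
  | zero => exact fun _ _ _ => rfl
  | succ k ih =>
    intro ξ ξ' h
    have hrun : run v g A ξ k = run v g A ξ' k :=
      ih fun j hj => h j (Set.mem_Iio.2 (Nat.lt_succ_of_lt hj))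
    simp only [run, hrun, h k (Set.mem_Iio.2 k.lt_succ_self)]

lemma dependsOn_headSet (coin : Fin n → Ξ → Bool) (s u : ℝ≥0∞) (k : ℕ) :
    DependsOn (headSet v g A coin s u k) (Set.Iio k) := fun ξ ξ' h => by
  have hrun : run v g A ξ k = run v g A ξ' k := dependsOn_run v g A k h
  simp only [headSet, CompletesIn, Completes, calleeState, callee, time, hrun]

variable {v A} [MeasurableSpace Ξ] {D : Measure Ξ} {coin : Fin n → Ξ → Bool}
  {p : Fin n → ℝ}

lemma sum_real_headSet (hp : ∀ i, D.real {y | coin i y = true} = p i) (s u : ℝ≥0∞) (ξ : ℕ → Ξ)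
    (k : ℕ) :
    ∑ j ∈ Finset.range k, D.real (headSet v g A coin s u j ξ) =
      ∑ i, p i * callCount v g A ξ s u i k := by
  classical
  simp only [callCount, Nat.count_eq_card_filter_range, Finset.natCast_card_filter, Finset.mul_sum]
  rw [Finset.sum_comm]
  refine Finset.sum_congr rfl fun j _ => ?_
  by_cases hc : CompletesIn v g A ξ s u j <;> simp [headSet, hc, hp]

theorem measure_exists_le_headCount_le [Countable Ξ] [MeasurableSingletonClass Ξ]
    [IsProbabilityMeasure D] (hA : IsZeroRespecting A) (hfin : ∀ i, ∀ t ≠ ⊤, work (v i) t ≠ ⊤)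
    (hp : ∀ i, D.real {y | coin i y = true} = p i) {s u : ℝ≥0∞} {m : ℕ}
    (hm : ∑ i, ENNReal.ofReal (p i) * (1 + (work (v i) u - work (v i) s)) ≤
      ENNReal.ofReal (m / 4)) :
    draws D {ξ | ∃ k, m ≤ headCount v g A ξ coin s u k} ≤
      ENNReal.ofReal (Real.exp (-(m / 4))) := by
  have hp0 (i : Fin n) : 0 ≤ p i := hp i ▸ measureReal_nonneg
  refine (measure_exists_le_hitCount_le D (dependsOn_headSet v g A coin s u) (fun ξ k => ?_)
    m).trans (ofReal_exp_quarter_div_two_pow_le m)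
  rw [sum_real_headSet g hp, ← ENNReal.ofReal_le_ofReal_iff (by positivity),
    ENNReal.ofReal_sum_of_nonneg fun i _ => mul_nonneg (hp0 i) (Nat.cast_nonneg _)]
  refine (Finset.sum_le_sum fun i _ => ?_).trans hm
  rw [ENNReal.ofReal_mul (hp0 i), ENNReal.ofReal_natCast]
  gcongr
  exact callCount_le hA (hfin i) s u k

end Heads

end Protocol

/-! ### The work done until the end of a window -/

section Window

open Filter Topology

lemma work_eq_setLIntegral_lt (v : ℝ → ℝ) (u : ℝ≥0∞) :
    work v u = ∫⁻ τ in {τ : ℝ | 0 ≤ τ ∧ ENNReal.ofReal τ < u}, ENNReal.ofReal (v τ) := by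
  refine MeasureTheory.setLIntegral_congr ?_
  filter_upwards [MeasureTheory.Measure.ae_ne MeasureTheory.volume u.toReal] with τ hτ
  refine propext (and_congr_right fun hτ0 => ⟨fun hle => hle.lt_of_ne ?_, le_of_lt⟩)
  rintro rfl
  exact hτ (ENNReal.toReal_ofReal hτ0).symm

lemma tendsto_work (v : ℝ → ℝ) {u : ℝ≥0∞} {t : ℕ → ℝ≥0∞} (hmono : Monotone t)
    (hlt : ∀ k, t k < u) (ht : Tendsto t atTop (𝓝 u)) :
    Tendsto (fun k => work v (t k)) atTop (𝓝 (work v u)) := by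
  have hset : {τ : ℝ | 0 ≤ τ ∧ ENNReal.ofReal τ < u} =
      ⋃ k, {τ : ℝ | 0 ≤ τ ∧ ENNReal.ofReal τ ≤ t k} := by
    ext τ
    simp only [Set.mem_ofPred_eq, Set.mem_iUnion, exists_and_left, and_congr_right_iff]
    refine fun _ => ⟨fun h => ?_, fun ⟨k, hk⟩ => hk.trans_lt (hlt k)⟩
    exact (ht.eventually (lt_mem_nhds h)).exists.imp fun _ => le_of_lt
  have hsup : work v u = ⨆ k, work v (t k) := by
    rw [work_eq_setLIntegral_lt, hset, MeasureTheory.setLIntegral_iUnion_of_directed]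
    · rfl
    · exact Monotone.directed_le fun k l hkl τ hτ => ⟨hτ.1, hτ.2.trans (hmono hkl)⟩
  rw [hsup]
  exact tendsto_atTop_iSup fun k l hkl => work_mono v (hmono hkl)

variable {n : ℕ} (v : Fin n → ℝ → ℝ)

/-- The end of the window that starts at time `s`, with the threshold `max θ 1` for the harmonic
mean of the scaled work; this is the recursion of `lowerTime` for `c₃ = 1`. -/
def windowEnd (ℓ θ : ℝ) (s : ℝ≥0∞) : ℝ≥0∞ :=
  sInf ((fun t : ℝ≥0 => (t : ℝ≥0∞)) '' {t : ℝ≥0 |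
    ENNReal.ofReal (max θ 1) ≤ harmonicMean fun i => scaledCount (v i) 1 ℓ s t})

lemma lowerTime_succ (c₂ ℓ σ ε : ℝ) (k : ℕ) :
    lowerTime v c₂ 1 ℓ σ ε (k + 1) =
      windowEnd v ℓ (c₂ * (σ ^ 2 / (n * ε))) (lowerTime v c₂ 1 ℓ σ ε k) :=
  rfl

variable {v} {ℓ θ : ℝ} {s : ℝ≥0∞}

lemma harmonicMean_lt_of_lt_windowEnd {t : ℝ≥0} (ht : t < windowEnd v ℓ θ s) :
    harmonicMean (fun i => scaledCount (v i) 1 ℓ s t) < ENNReal.ofReal (max θ 1) :=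
  lt_of_not_ge fun hge => ht.not_ge (sInf_le ⟨t, hge, rfl⟩)

lemma one_le_harmonicMean {b : Fin n → ℕ} (hb : ∀ i, 1 ≤ b i) : 1 ≤ harmonicMean b := by
  rw [harmonicMean, ENNReal.one_le_inv]
  refine ENNReal.div_le_of_le_mul ?_
  calc ∑ i, (b i : ℝ≥0∞)⁻¹ ≤ ∑ _i : Fin n, 1 :=
        Finset.sum_le_sum fun i _ => ENNReal.inv_le_one.2 (mod_cast hb i)
    _ = 1 * n := by simp

lemma natCast_le_mul_sum_inv_of_harmonicMean_lt {b : Fin n → ℕ} (hb : ∀ i, 1 ≤ b i)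
    (h : harmonicMean b < ENNReal.ofReal (max θ 1)) :
    (n : ℝ≥0∞) ≤ ENNReal.ofReal θ * ∑ i, (b i : ℝ≥0∞)⁻¹ := by
  rcases n.eq_zero_or_pos with rfl | hn
  · simp
  have hθ : 1 < ENNReal.ofReal θ := by
    have hmax := (one_le_harmonicMean hb).trans_lt h
    rwa [ENNReal.ofReal_max, ENNReal.ofReal_one, lt_max_iff, or_iff_left (lt_irrefl _)] at hmax
  rw [ENNReal.ofReal_max, ENNReal.ofReal_one, max_eq_left hθ.le, harmonicMean,
    ENNReal.inv_div (.inl (ENNReal.natCast_ne_top n)) (.inl (mod_cast hn.ne'))] at h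
  exact (ENNReal.div_le_iff_le_mul (.inr ENNReal.ofReal_ne_top)
    (.inr (one_pos.trans hθ).ne')).1 h.le

lemma one_le_floor_div (hℓ : 0 < ℓ) {r : ℝ} (hr : ℓ ≤ r) : 1 ≤ ⌊r / ℓ⌋₊ :=
  Nat.le_floor (by rwa [Nat.cast_one, one_le_div hℓ])

lemma le_two_mul_floor_div (hℓ : 0 < ℓ) {r : ℝ} (hr : ℓ ≤ r) : r ≤ 2 * ℓ * ⌊r / ℓ⌋₊ := by
  have hone : (1 : ℝ) ≤ ⌊r / ℓ⌋₊ := mod_cast one_le_floor_div hℓ hr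
  have hlt := (div_lt_iff₀ hℓ).1 (Nat.lt_floor_add_one (r / ℓ))
  nlinarith

variable {w : ℝ → ℝ} {t : ℝ≥0}

lemma one_le_scaledCount (hℓ : 0 < ℓ) (hfin : work w t ≠ ⊤)
    (hW : ENNReal.ofReal ℓ ≤ work w t - work w s) : 1 ≤ scaledCount w 1 ℓ s t := by
  rw [scaledCount, one_mul]
  exact one_le_floor_div hℓ ((ENNReal.ofReal_le_iff_le_toReal (ENNReal.sub_ne_top hfin)).1 hW)

lemma inv_scaledCount_le (hℓ : 0 < ℓ) (hfin : work w t ≠ ⊤)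
    (hW : ENNReal.ofReal ℓ ≤ work w t - work w s) :
    (scaledCount w 1 ℓ s t : ℝ≥0∞)⁻¹ ≤ ENNReal.ofReal (2 * ℓ) * (work w t - work w s)⁻¹ := by
  have hr : work w t - work w s ≠ ⊤ := ENNReal.sub_ne_top hfin
  have hr0 : work w t - work w s ≠ 0 := ((ENNReal.ofReal_pos.2 hℓ).trans_le hW).ne'
  have hle : work w t - work w s ≤ ENNReal.ofReal (2 * ℓ) * scaledCount w 1 ℓ s t := by
    rw [← ENNReal.ofReal_natCast, ← ENNReal.ofReal_mul (by positivity), scaledCount, one_mul,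
      ENNReal.le_ofReal_iff_toReal_le hr (by positivity)]
    exact le_two_mul_floor_div hℓ ((ENNReal.ofReal_le_iff_le_toReal hr).1 hW)
  rw [← div_eq_mul_inv, ENNReal.le_div_iff_mul_le (.inl hr0) (.inl hr), mul_comm]
  exact ENNReal.div_le_of_le_mul hle

lemma natCast_le_mul_sum_inv_of_lt_windowEnd (hℓ : 0 < ℓ) (hfin : ∀ i, work (v i) t ≠ ⊤)
    (ht : t < windowEnd v ℓ θ s)
    (hW : ∀ i, ENNReal.ofReal ℓ ≤ work (v i) t - work (v i) s) :
    (n : ℝ≥0∞) ≤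
      ENNReal.ofReal θ * (ENNReal.ofReal (2 * ℓ) * ∑ i, (work (v i) t - work (v i) s)⁻¹) := by
  refine (natCast_le_mul_sum_inv_of_harmonicMean_lt
    (fun i => one_le_scaledCount hℓ (hfin i) (hW i)) (harmonicMean_lt_of_lt_windowEnd ht)).trans ?_
  rw [Finset.mul_sum Finset.univ _ (ENNReal.ofReal (2 * ℓ))]
  gcongr with i
  exact inv_scaledCount_le hℓ (hfin i) (hW i)

theorem natCast_le_mul_sum_inv_windowEnd (hn : 0 < n) (hℓ : 0 < ℓ)
    (hfin : ∀ i, ∀ t ≠ ⊤, work (v i) t ≠ ⊤) {u : ℝ≥0∞} (hu : windowEnd v ℓ θ s = u)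
    (hW : ∀ i, ENNReal.ofReal ℓ < work (v i) u - work (v i) s) :
    (n : ℝ≥0∞) ≤
      ENNReal.ofReal θ * (ENNReal.ofReal (2 * ℓ) * ∑ i, (work (v i) u - work (v i) s)⁻¹) := by
  have hsu : s < u := lt_of_not_ge fun hus => by
    simpa [tsub_eq_zero_of_le (work_mono _ hus)] using hW ⟨0, hn⟩
  obtain ⟨t, tmono, tlt, ttend⟩ := exists_seq_strictMono_tendsto' (pos_of_gt hsu)
  have hwork (i : Fin n) : Tendsto (fun k => work (v i) (t k) - work (v i) s) atTop
      (𝓝 (work (v i) u - work (v i) s)) :=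
    ENNReal.Tendsto.sub (tendsto_work (v i) tmono.monotone (fun k => (tlt k).2) ttend)
      tendsto_const_nhds (.inr (hfin i s hsu.ne_top))
  have hlim := ENNReal.Tendsto.const_mul (ENNReal.Tendsto.const_mul
    (tendsto_finsetSum Finset.univ fun i _ => (hwork i).inv)
    (.inr (ENNReal.ofReal_ne_top (r := 2 * ℓ)))) (.inr (ENNReal.ofReal_ne_top (r := θ)))
  refine ge_of_tendsto hlim ?_
  filter_upwards [eventually_all.2 fun i => (hwork i).eventually (lt_mem_nhds (hW i))] with k hk
  have htop : t k ≠ ⊤ := (tlt k).2.ne_top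
  rw [← ENNReal.coe_toNNReal htop] at hk ⊢
  refine natCast_le_mul_sum_inv_of_lt_windowEnd hℓ (fun i => hfin i _ ENNReal.coe_ne_top) ?_
    fun i => (hk i).le
  rw [ENNReal.coe_toNNReal htop, hu]
  exact (tlt k).2

end Window

/-! ### The weights of a block -/

section BlockDesign

variable {n : ℕ} {a ℓ σ : ℝ} {W : Fin n → ℝ≥0∞}

/-- Weights `w i` with average one and heads probabilities `p i` of the workers for one block of
the chain. A stochastic partial derivative of size `a * w i` that is revealed with probability
`p i` has variance at most `σ ^ 2`, and at most `2 * ℓ` heads are expected in a window in which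
worker `i` does the work `W i`. -/
structure IsBlockDesign (a ℓ σ : ℝ) (W : Fin n → ℝ≥0∞) (w : Fin n → ℝ)
    (p : Fin n → unitInterval) : Prop where
  nonneg : ∀ i, 0 ≤ w i
  sum_eq : ∑ i, w i = n
  variance_le : ∀ i, (a * w i) ^ 2 * (1 - p i) ≤ σ ^ 2 * p i
  work_le : ∑ i, ENNReal.ofReal (p i) * (1 + W i) ≤ ENNReal.ofReal (2 * ℓ)

lemma isBlockDesign_single (hℓ : 1 ≤ ℓ) {i : Fin n} (hi : W i ≤ ENNReal.ofReal ℓ) :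
    IsBlockDesign a ℓ σ W (Pi.single i (n : ℝ)) (Pi.single i 1) where
  nonneg j := Pi.single_nonneg (α := fun _ => ℝ).2 (Nat.cast_nonneg n) j
  sum_eq := by simp
  variance_le j := by
    rcases eq_or_ne j i with rfl | hj
    · simp [sq_nonneg]
    · simp [hj]
  work_le := by
    rw [Finset.sum_eq_single i (fun j _ hj => by simp [hj]) (by simp)]
    simp only [Pi.single_eq_same, Set.Icc.coe_one, ENNReal.ofReal_one, one_mul]
    calc 1 + W i ≤ ENNReal.ofReal ℓ + ENNReal.ofReal ℓ :=
          add_le_add (ENNReal.one_le_ofReal.2 hℓ) hi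
      _ = ENNReal.ofReal (2 * ℓ) := by
        rw [← ENNReal.ofReal_add (by linarith) (by linarith), two_mul]

lemma ofReal_mul_sq_mul_one_add_le {r : ℝ≥0∞} (hr : 1 ≤ r) {c : ℝ} (hc : 0 ≤ c) :
    ENNReal.ofReal (c * r⁻¹.toReal ^ 2) * (1 + r) ≤ ENNReal.ofReal (2 * c * r⁻¹.toReal) := by
  rcases eq_or_ne r ⊤ with rfl | htop
  · simp
  have hpos : 0 < r.toReal := ENNReal.toReal_pos (one_pos.trans_le hr).ne' htop
  calc ENNReal.ofReal (c * r⁻¹.toReal ^ 2) * (1 + r)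
      ≤ ENNReal.ofReal (c * r⁻¹.toReal ^ 2) * ENNReal.ofReal (2 * r.toReal) := by
        rw [ENNReal.ofReal_mul zero_le_two, ENNReal.ofReal_toReal htop, ENNReal.ofReal_ofNat,
          two_mul]
        gcongr
    _ = ENNReal.ofReal (2 * c * r⁻¹.toReal) := by
        rw [← ENNReal.ofReal_mul (by positivity), ENNReal.toReal_inv]
        congr 1
        field_simp

lemma sum_ofReal_mul_one_add_le (hW : ∀ i, 1 ≤ W i) {c : ℝ} (hc : 0 ≤ c) {p : Fin n → ℝ}
    (hp : ∀ i, p i ≤ c * (W i)⁻¹.toReal ^ 2) :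
    ∑ i, ENNReal.ofReal (p i) * (1 + W i) ≤ ENNReal.ofReal (2 * c * ∑ i, (W i)⁻¹.toReal) := by
  rw [Finset.mul_sum, ENNReal.ofReal_sum_of_nonneg fun i _ => by positivity]
  refine Finset.sum_le_sum fun i _ => le_trans ?_ (ofReal_mul_sq_mul_one_add_le (hW i) hc)
  gcongr
  exact hp i

/-- Weights proportional to `1 / W i` balance the expected numbers of heads of the workers. -/
lemma exists_isBlockDesign_of_le_sum_inv (hn : 0 < n) (ha : 0 < a) (hW : ∀ i, 1 ≤ W i)
    (hsum : (a * n) ^ 2 ≤ ℓ * σ ^ 2 * ∑ i, (W i)⁻¹.toReal) :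
    ∃ w p, IsBlockDesign a ℓ σ W w p := by
  set S : ℝ := ∑ i, (W i)⁻¹.toReal with hS
  have : 0 ≤ S := Finset.sum_nonneg fun i _ => ENNReal.toReal_nonneg
  have hpos : ℓ * σ ^ 2 * S ≠ 0 := (lt_of_lt_of_le (by positivity) hsum).ne'
  have hSne : S ≠ 0 := right_ne_zero_of_mul hpos
  have hσ : σ ≠ 0 := (pow_ne_zero_iff two_ne_zero).1
    (right_ne_zero_of_mul (left_ne_zero_of_mul hpos))
  set c : ℝ := (a * n / S) ^ 2 / σ ^ 2 with hc
  have hc0 : 0 ≤ c := by positivity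
  have hq0 (i : Fin n) : 0 ≤ c * (W i)⁻¹.toReal ^ 2 := by positivity
  refine ⟨fun i => n * (W i)⁻¹.toReal / S, fun i => ⟨min 1 (c * (W i)⁻¹.toReal ^ 2),
    le_min zero_le_one (hq0 i), min_le_left _ _⟩, fun i => by positivity, ?_, fun i => ?_, ?_⟩
  · rw [← Finset.sum_div, ← Finset.mul_sum, ← hS, mul_div_cancel_right₀ _ hSne]
  · have hq : (a * (n * (W i)⁻¹.toReal / S)) ^ 2 = σ ^ 2 * (c * (W i)⁻¹.toReal ^ 2) := by
      rw [hc]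
      field_simp
    rw [hq, mul_assoc]
    gcongr
    rcases min_cases 1 (c * (W i)⁻¹.toReal ^ 2) with ⟨h, -⟩ | ⟨h, -⟩ <;> simp only [h] <;>
      nlinarith [hq0 i]
  · refine (sum_ofReal_mul_one_add_le hW hc0 fun i => min_le_right _ _).trans ?_
    gcongr ENNReal.ofReal ?_
    calc 2 * c * S = 2 * ((a * n) ^ 2 / (σ ^ 2 * S)) := by
          rw [hc]
          field_simp
      _ ≤ 2 * ℓ := by
          gcongr
          rw [div_le_iff₀ (by positivity)]
          linarith

theorem exists_isBlockDesign_windowEnd (hn : 0 < n) {v : Fin n → ℝ → ℝ}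
    (hfin : ∀ i, ∀ t ≠ ⊤, work (v i) t ≠ ⊤) (ha : 0 < a) (hℓ : 1 ≤ ℓ) (σ : ℝ) (s : ℝ≥0∞) :
    ∃ w p, IsBlockDesign a ℓ σ
      (fun i => work (v i) (windowEnd v ℓ (σ ^ 2 / (2 * n * a ^ 2)) s) - work (v i) s) w p := by
  generalize hu : windowEnd v ℓ (σ ^ 2 / (2 * n * a ^ 2)) s = u
  by_cases! hslow : ∃ i, work (v i) u - work (v i) s ≤ ENNReal.ofReal ℓ
  · obtain ⟨i, hi⟩ := hslow
    exact ⟨_, _, isBlockDesign_single hℓ hi⟩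
  · have hone (i : Fin n) : 1 ≤ work (v i) u - work (v i) s :=
      (ENNReal.one_le_ofReal.2 hℓ).trans (hslow i).le
    have hinv (i : Fin n) : (work (v i) u - work (v i) s)⁻¹ ≠ ⊤ :=
      ENNReal.inv_ne_top.2 (one_pos.trans_le (hone i)).ne'
    refine exists_isBlockDesign_of_le_sum_inv hn ha hone ?_
    have hle := ENNReal.toReal_mono
      (ENNReal.mul_ne_top ENNReal.ofReal_ne_top
        (ENNReal.mul_ne_top ENNReal.ofReal_ne_top (ENNReal.sum_ne_top.2 fun i _ => hinv i)))
      (natCast_le_mul_sum_inv_windowEnd hn (by linarith) hfin hu hslow)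
    have hnR : (0 : ℝ) < n := mod_cast hn
    rw [ENNReal.toReal_natCast, ENNReal.toReal_mul, ENNReal.toReal_mul,
      ENNReal.toReal_ofReal (by positivity), ENNReal.toReal_ofReal (by positivity),
      ENNReal.toReal_sum fun i _ => hinv i, div_mul_eq_mul_div, le_div_iff₀ (by positivity)] at hle
    linarith

end BlockDesign

/-! ### Gradients with one coordinate revealed by a coin -/

section Coins

open MeasureTheory ProbabilityTheory

variable {ι : Type} [Fintype ι] (p : ι → unitInterval)

/-- The law of independent coins, where coin `i` shows heads (`true`) with probability `p i`. -/
abbrev coinLaw : Measure (ι → Bool) := Measure.pi fun i => bernoulliMeasure true false (p i)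

lemma coinLaw_real_heads (i : ι) : (coinLaw p).real {y | y i = true} = p i := by
  have hi := measurePreserving_eval (fun i => bernoulliMeasure true false (p i)) i
  have hset : MeasurableSet {true} := measurableSet_singleton true
  exact (hi.measureReal_preimage hset.nullMeasurableSet).trans
    (bernoulliMeasure_real_apply_of_mem_of_notMem _ hset (by simp) (by simp))

lemma integral_coinLaw {E : Type*} [NormedAddCommGroup E] [NormedSpace ℝ E] [CompleteSpace E]
    (i : ι) (φ : Bool → E) :
    ∫ y, φ (y i) ∂coinLaw p = (p i : ℝ) • φ true + (1 - p i : ℝ) • φ false := by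
  have hi := measurePreserving_eval (fun i => bernoulliMeasure true false (p i)) i
  rw [← integral_bernoulliMeasure true false (p i) φ, ← hi.map_eq]
  exact (integral_map hi.measurable.aemeasurable
    StronglyMeasurable.of_discrete.aestronglyMeasurable).symm

/-- The relative noise of a coordinate that is multiplied by `1 / p` with probability `p` and
by `0` otherwise. It is not centered for `p = 0`. -/
def coinNoise (p : ℝ) (b : Bool) : ℝ := if b = true then 1 / p - 1 else -1

lemma mean_coinNoise {p : ℝ} (hp : p ≠ 0) :
    p * coinNoise p true + (1 - p) * coinNoise p false = 0 := by
  simp only [coinNoise, if_true, Bool.false_eq_true, if_false]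
  field_simp
  ring

lemma second_moment_coinNoise {p : ℝ} (hp : p ≠ 0) :
    p * coinNoise p true ^ 2 + (1 - p) * coinNoise p false ^ 2 = (1 - p) / p := by
  simp only [coinNoise, if_true, Bool.false_eq_true, if_false]
  field_simp
  ring

variable {d : ℕ}

/-- The component of `u` along coordinate `N`, which is zero for `d ≤ N`. -/
def coordPart (u : Vec d) (N : ℕ) : Vec d :=
  if h : N < d then EuclideanSpace.single ⟨N, h⟩ (u ⟨N, h⟩) else 0

lemma coordPart_apply (u : Vec d) (N : ℕ) (j : Fin d) :
    coordPart u N j = if N = j then u j else 0 := by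
  unfold coordPart
  split_ifs with hN hj hj
  · obtain rfl : j = ⟨N, hN⟩ := Fin.ext hj.symm
    simp
  · have : j ≠ ⟨N, hN⟩ := fun e => hj (by rw [e])
    simp [this]
  · exact absurd j.2 (hj ▸ hN)
  · rfl

lemma norm_coordPart_le {u : Vec d} {N : ℕ} {r : ℝ} (hr : 0 ≤ r)
    (hu : ∀ h : N < d, |u ⟨N, h⟩| ≤ r) : ‖coordPart u N‖ ≤ r := by
  unfold coordPart
  split_ifs with h
  · simpa using hu h
  · simpa using hr

/-- The vector `u` with its coordinate `N` replaced by a noisy version, where `b` is the outcome of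
a coin that shows heads with probability `p`. -/
def coinReveal (u : Vec d) (N : ℕ) (p : ℝ) (b : Bool) : Vec d := u + coinNoise p b • coordPart u N

lemma prog_coinReveal_le_succ {u : Vec d} {N : ℕ} (hu : prog u ≤ N + 1) (p : ℝ) (b : Bool) :
    prog (coinReveal u N p b) ≤ N + 1 :=
  prog_le_iff.2 fun j hj => by
    simp [coinReveal, coordPart_apply, prog_le_iff.1 hu j hj]

lemma prog_coinReveal_false_le {u : Vec d} {N : ℕ} (hu : prog u ≤ N + 1) (p : ℝ) :
    prog (coinReveal u N p false) ≤ N :=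
  prog_le_iff.2 fun j hj => by
    rcases hj.eq_or_lt with rfl | hlt
    · simp [coinReveal, coinNoise, coordPart_apply]
    · simp [coinReveal, coordPart_apply, prog_le_iff.1 hu j hlt]

variable {p}

lemma integral_coinReveal {u : Vec d} {N : ℕ} {i : ι} (h0 : (p i : ℝ) = 0 → coordPart u N = 0) :
    ∫ y, coinReveal u N (p i) (y i) ∂coinLaw p = u := by
  have hmean : ((p i : ℝ) * coinNoise (p i) true + (1 - p i) * coinNoise (p i) false) •
      coordPart u N = 0 := by
    rcases eq_or_ne (p i : ℝ) 0 with hp | hp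
    · rw [h0 hp, smul_zero]
    · rw [mean_coinNoise hp, zero_smul]
  rw [integral_coinLaw p i (coinReveal u N (p i))]
  calc _ = u + ((p i : ℝ) * coinNoise (p i) true + (1 - p i) * coinNoise (p i) false) •
      coordPart u N := by
        unfold coinReveal
        module
    _ = u := by rw [hmean, add_zero]

lemma integral_norm_coinReveal_sub_sq_le {u : Vec d} {N : ℕ} {i : ι} {σ : ℝ}
    (hvar : ‖coordPart u N‖ ^ 2 * (1 - p i) ≤ σ ^ 2 * p i) :
    ∫ y, ‖coinReveal u N (p i) (y i) - u‖ ^ 2 ∂coinLaw p ≤ σ ^ 2 := by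
  have hnorm (b : Bool) : ‖coinReveal u N (p i) b - u‖ ^ 2 =
      coinNoise (p i) b ^ 2 * ‖coordPart u N‖ ^ 2 := by
    rw [coinReveal, add_sub_cancel_left, norm_smul, mul_pow, Real.norm_eq_abs, sq_abs]
  rw [integral_coinLaw p i fun b => ‖coinReveal u N (p i) b - u‖ ^ 2]
  simp only [hnorm, smul_eq_mul, ← mul_assoc, ← add_mul]
  rcases (p i).2.1.eq_or_lt with hp | hp
  · rw [← hp] at hvar ⊢
    simp only [coinNoise]
    nlinarith [sq_nonneg σ]
  · rw [second_moment_coinNoise hp.ne', div_mul_eq_mul_div, div_le_iff₀ hp]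
    linarith

theorem isStochasticGradient_coinReveal {σ : ℝ} {f : Vec d → ℝ} {G : Vec d → Vec d}
    (hG : ∀ x, gradient f x = G x) (N : Vec d → ℕ) (i : Vec d → ι)
    (hvar : ∀ x, ‖coordPart (G x) (N x)‖ ^ 2 * (1 - p (i x)) ≤ σ ^ 2 * p (i x)) :
    IsStochasticGradient σ (coinLaw p) f
      (fun x y _ => coinReveal (G x) (N x) (p (i x)) (y (i x))) where
  integrable _ _ := Integrable.of_finite
  unbiased x _ := by
    rw [hG]
    refine integral_coinReveal fun hp => ?_
    have h := hvar x
    rw [hp, sub_zero, mul_one, mul_zero] at h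
    exact norm_eq_zero.1 (pow_eq_zero_iff two_ne_zero |>.1 (le_antisymm h (sq_nonneg _)))
  sq_integrable _ _ := Integrable.of_finite
  variance_le x _ := by
    rw [hG]
    exact integral_norm_coinReveal_sub_sq_le (hvar x)

end Coins

/-! ### The best squared gradient norm -/

section Best

open MeasureTheory

variable {n d : ℕ} {Ξ : Type} (v : Fin n → ℝ → ℝ) (g : Fin n → Vec d → Ξ → ℝ≥0 → Vec d)
  {A : Algorithm n d} (f : Vec d → ℝ) (t : ℝ≥0∞)

instance nonempty_indicesUpTo (ξ : ℕ → Ξ) : Nonempty (indicesUpTo v g A ξ t) :=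
  ⟨0, by simp [indicesUpTo, time]⟩

lemma bestSqGrad_nonneg (ξ : ℕ → Ξ) : 0 ≤ bestSqGrad v g A f t ξ :=
  Real.iInf_nonneg fun _ => sq_nonneg _

lemma bestSqGrad_le {ξ : ℕ → Ξ} {k : ℕ} (hk : k ∈ indicesUpTo v g A ξ t) :
    bestSqGrad v g A f t ξ ≤ ‖gradient f (iterate v g A ξ k)‖ ^ 2 :=
  ciInf_le (f := fun k : indicesUpTo v g A ξ t => ‖gradient f (iterate v g A ξ k)‖ ^ 2)
    ⟨0, Set.forall_mem_range.2 fun _ => sq_nonneg _⟩ ⟨k, hk⟩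

lemma bestSqGrad_le_norm_gradient_zero_sq (hA : IsZeroRespecting A) (ξ : ℕ → Ξ) :
    bestSqGrad v g A f t ξ ≤ ‖gradient f 0‖ ^ 2 := by
  have h0 : iterate v g A ξ 0 = 0 := by
    ext l
    by_contra h
    obtain ⟨j, -⟩ := hA.supp_subset 0 _ l h
    exact j.elim0
  exact h0 ▸ bestSqGrad_le v g f t (by simp [indicesUpTo, time])

-- The infimum over a random index set is an infimum over all of `ℕ`, hence measurable.
open Classical in
lemma bestSqGrad_eq_iInf (hA : IsZeroRespecting A) (ξ : ℕ → Ξ) : bestSqGrad v g A f t ξ =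
    ⨅ k : ℕ, if k ∈ indicesUpTo v g A ξ t then ‖gradient f (iterate v g A ξ k)‖ ^ 2
      else ‖gradient f 0‖ ^ 2 := by
  refine le_antisymm (le_ciInf fun k => ?_) (le_ciInf fun k => ?_)
  · split_ifs with h
    · exact bestSqGrad_le v g f t h
    · exact bestSqGrad_le_norm_gradient_zero_sq v g f t hA ξ
  · refine (ciInf_le ⟨0, Set.forall_mem_range.2 fun l => ?_⟩ (k : ℕ)).trans (if_pos k.2).le
    split_ifs <;> positivity

lemma dependsOn_iterate (k : ℕ) : DependsOn (fun ξ => iterate v g A ξ k) (Set.Iio k) :=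
  fun ξ ξ' h => by
    have hrun : run v g A ξ k = run v g A ξ' k := dependsOn_run v g A k h
    simp only [iterate, hrun]

lemma dependsOn_time (k : ℕ) : DependsOn (fun ξ => time v g A ξ k) (Set.Iio k) :=
  fun ξ ξ' h => by
    cases k with
    | zero => rfl
    | succ k =>
      have hrun : run v g A ξ k = run v g A ξ' k :=
        dependsOn_run v g A k fun j hj => h j (Set.mem_Iio.2 (Nat.lt_succ_of_lt hj))
      simp only [time, hrun]

variable [MeasurableSpace Ξ] [Countable Ξ] [MeasurableSingletonClass Ξ]

lemma measurable_bestSqGrad (hA : IsZeroRespecting A) : Measurable (bestSqGrad v g A f t) := by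
  classical
  rw [funext (bestSqGrad_eq_iInf v g f t hA)]
  refine Measurable.iInf fun k => measurable_of_dependsOn_Iio (k := k) fun ξ ξ' h => ?_
  have hiterate : iterate v g A ξ k = iterate v g A ξ' k := dependsOn_iterate v g k h
  have htime : time v g A ξ k = time v g A ξ' k := dependsOn_time v g k h
  have hmem : k ∈ indicesUpTo v g A ξ t ↔ k ∈ indicesUpTo v g A ξ' t := by
    simp only [indicesUpTo, Set.mem_ofPred_eq, htime]
  rw [hiterate]
  exact if_congr hmem rfl rfl

lemma integrable_bestSqGrad (D : Measure Ξ) [IsProbabilityMeasure D] (hA : IsZeroRespecting A) :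
    Integrable (bestSqGrad v g A f t) (draws D) := by
  refine Integrable.of_bound (measurable_bestSqGrad v g f t hA).aestronglyMeasurable
    (‖gradient f 0‖ ^ 2) (Filter.Eventually.of_forall fun ξ => ?_)
  rw [Real.norm_eq_abs, abs_of_nonneg (bestSqGrad_nonneg v g f t ξ)]
  exact bestSqGrad_le_norm_gradient_zero_sq v g f t hA ξ

end Best

/-! ### From few heads per window to the lower bound -/

section LowerBound

open MeasureTheory

variable {n d : ℕ} {Ξ : Type} {v : Fin n → ℝ → ℝ} {g : Fin n → Vec d → Ξ → ℝ≥0 → Vec d}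
  {A : Algorithm n d} {coin : Fin n → ℕ → Ξ → Bool} {T : ℕ → ℝ≥0∞} {K m : ℕ} {f : Vec d → ℝ}
  {t : ℝ≥0∞}

lemma le_bestSqGrad_of_headCount_lt (hA : IsZeroRespecting A)
    (hg : GatedBy g fun i N => coin i (N / m)) (hT : T 0 = 0) {ξ : ℕ → Ξ}
    (hheads : ∀ b < K, ∀ k, headCount v g A ξ (coin · b) (T b) (T (b + 1)) k < m) {r : ℝ}
    (hf : ∀ x, prog x ≤ K * m → r ≤ ‖gradient f x‖ ^ 2) (ht : t ≤ T K) :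
    r ≤ bestSqGrad v g A f t ξ :=
  le_ciInf fun k => hf _ <| (prog_iterate_le v g ξ hA k).trans <|
    discovered_le hA hg hT hheads (le_trans k.2 ht)

variable [MeasurableSpace Ξ] [Countable Ξ] [MeasurableSingletonClass Ξ] {D : Measure Ξ}
  [IsProbabilityMeasure D] {p : ℕ → Fin n → ℝ}

lemma measure_exists_window_le_headCount_le (g : Fin n → Vec d → Ξ → ℝ≥0 → Vec d)
    (hA : IsZeroRespecting A) (hfin : ∀ i, ∀ t ≠ ⊤, work (v i) t ≠ ⊤)
    (hp : ∀ b < K, ∀ i, D.real {y | coin i b y = true} = p b i)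
    (hwork : ∀ b < K, ∑ i, ENNReal.ofReal (p b i) *
      (1 + (work (v i) (T (b + 1)) - work (v i) (T b))) ≤ ENNReal.ofReal (m / 4)) :
    draws D {ξ | ∃ b < K, ∃ k, m ≤ headCount v g A ξ (coin · b) (T b) (T (b + 1)) k} ≤
      ENNReal.ofReal (K * Real.exp (-(m / 4))) :=
  calc _ ≤ draws D (⋃ b ∈ Finset.range K,
        {ξ | ∃ k, m ≤ headCount v g A ξ (coin · b) (T b) (T (b + 1)) k}) :=
        measure_mono fun ξ hξ => by
          obtain ⟨b, hb, hk⟩ := hξ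
          exact Set.mem_biUnion (Finset.mem_coe.2 (Finset.mem_range.2 hb)) hk
    _ ≤ ∑ b ∈ Finset.range K,
        draws D {ξ | ∃ k, m ≤ headCount v g A ξ (coin · b) (T b) (T (b + 1)) k} :=
        measure_biUnion_finset_le _ _
    _ ≤ ∑ _b ∈ Finset.range K, ENNReal.ofReal (Real.exp (-(m / 4))) :=
        Finset.sum_le_sum fun b hb => measure_exists_le_headCount_le g hA hfin
          (hp b (Finset.mem_range.1 hb)) (hwork b (Finset.mem_range.1 hb))
    _ = ENNReal.ofReal (K * Real.exp (-(m / 4))) := by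
        rw [Finset.sum_const, Finset.card_range, nsmul_eq_mul,
          ENNReal.ofReal_mul (Nat.cast_nonneg K), ENNReal.ofReal_natCast]

theorem lt_integral_bestSqGrad (hA : IsZeroRespecting A)
    (hfin : ∀ i, ∀ t ≠ ⊤, work (v i) t ≠ ⊤) (hg : GatedBy g fun i N => coin i (N / m))
    (hp : ∀ b < K, ∀ i, D.real {y | coin i b y = true} = p b i) (hT : T 0 = 0)
    (hwork : ∀ b < K, ∑ i, ENNReal.ofReal (p b i) *
      (1 + (work (v i) (T (b + 1)) - work (v i) (T b))) ≤ ENNReal.ofReal (m / 4))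
    (hK : K * Real.exp (-(m / 4)) < 1 / 2) {ε : ℝ} (hε : 0 < ε)
    (hf : ∀ x, prog x ≤ K * m → 2 * ε ≤ ‖gradient f x‖ ^ 2) (ht : t ≤ T K) :
    ε < ∫ ξ, bestSqGrad v g A f t ξ ∂draws D := by
  have hsmall : {ξ | 2 * ε ≤ bestSqGrad v g A f t ξ}ᶜ ⊆
      {ξ | ∃ b < K, ∃ k, m ≤ headCount v g A ξ (coin · b) (T b) (T (b + 1)) k} := by
    refine Set.compl_subset_comm.1 fun ξ hξ => ?_
    simp only [Set.mem_compl_iff, Set.mem_ofPred_eq, not_exists, not_and, not_le] at hξ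
    exact le_bestSqGrad_of_headCount_lt hA hg hT hξ hf ht
  have hprob : (draws D).real {ξ | 2 * ε ≤ bestSqGrad v g A f t ξ}ᶜ < 1 / 2 :=
    (ENNReal.toReal_le_of_le_ofReal (by positivity) ((measure_mono hsmall).trans
      (measure_exists_window_le_headCount_le g hA hfin hp hwork))).trans_lt hK
  rw [probReal_compl_eq_one_sub
    (measurableSet_le measurable_const (measurable_bestSqGrad v g f t hA))] at hprob
  have hmarkov : 2 * ε * (draws D).real {ξ | 2 * ε ≤ bestSqGrad v g A f t ξ} ≤
      ∫ ξ, bestSqGrad v g A f t ξ ∂draws D :=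
    mul_meas_ge_le_integral_of_nonneg (Filter.Eventually.of_forall (bestSqGrad_nonneg v g f t))
      (integrable_bestSqGrad v g f t D hA) (2 * ε)
  nlinarith

end LowerBound

/-! ### The hard instance -/

section Instance

open MeasureTheory

variable {n d : ℕ}

lemma average_scaledChain (a lam : ℝ) (w : Fin n → ℕ → ℝ) :
    average (fun i => (scaledChain a lam (w i) : Vec d → ℝ)) =
      scaledChain a lam fun j => 1 / n * ∑ i, w i j := by
  funext x
  simp only [average, scaledChain, chain, ← Finset.mul_sum]
  rw [Finset.sum_comm]
  simp only [Finset.mul_sum, Finset.sum_mul]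
  exact Finset.sum_congr rfl fun j _ => Finset.sum_congr rfl fun i _ => by ring

lemma neg_le_scaledChain {a L : ℝ} (ha : 0 ≤ a) (hL : 0 ≤ L) {w : ℕ → ℝ} (hw : ∀ j, 0 ≤ w j)
    (x : Vec d) :
    -(72 * a ^ 2 * (∑ j ∈ Finset.range (d + 1), w j) / L) ≤ scaledChain a (18 * a / L) w x :=
  calc _ = a * (18 * a / L) * -(4 * ∑ j ∈ Finset.range (d + 1), w j) := by ring
    _ ≤ _ := mul_le_mul_of_nonneg_left (neg_four_mul_sum_le_chain hw _) (by positivity)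

lemma inClass_scaledChain {L Δ a : ℝ} (hL : 0 < L) (ha : 0 < a) {w : ℕ → ℝ}
    (hw0 : ∀ j, 0 ≤ w j) (hw1 : ∀ j, w j ≤ 1)
    (hgap : 72 * a ^ 2 * ∑ j ∈ Finset.range (d + 1), w j ≤ L * Δ) :
    InClass L Δ (scaledChain a (18 * a / L) w : Vec d → ℝ) := by
  have hlam : 18 * a / L ≠ 0 := by positivity
  refine ⟨fun x => (hasGradientAt_scaledChain w a hlam x).differentiableAt, fun x y => ?_,
    -(72 * a ^ 2 * (∑ j ∈ Finset.range (d + 1), w j) / L), neg_le_scaledChain ha.le hL.le hw0, ?_⟩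
  · rw [gradient_scaledChain w a hlam, gradient_scaledChain w a hlam, ← smul_sub, norm_smul,
      Real.norm_of_nonneg ha.le]
    calc _ ≤ a * (18 * ‖(18 * a / L)⁻¹ • x - (18 * a / L)⁻¹ • y‖) := by
          gcongr
          exact norm_chainGrad_sub_le (fun j => abs_le.2 ⟨by linarith [hw0 j], hw1 j⟩) _ _
      _ = L * ‖x - y‖ := by
          rw [← smul_sub, norm_smul, Real.norm_of_nonneg (by positivity)]
          field_simp
  · have hzero : scaledChain a (18 * a / L) w (0 : Vec d) ≤ 0 := by
      rw [scaledChain, smul_zero]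
      exact mul_nonpos_of_nonneg_of_nonpos (by positivity) (chain_zero_nonpos hw0)
    have hΔ : 72 * a ^ 2 * (∑ j ∈ Finset.range (d + 1), w j) / L ≤ Δ :=
      (div_le_iff₀' hL).2 hgap
    linarith

variable {ι : Type}

/-- The gradient of `scaledChain a lam w` at `x`, with its first undiscovered coordinate revealed
by coin `c (prog x)`. -/
def coinGrad (a lam : ℝ) (w : ℕ → ℝ) (p : ι → unitInterval) (c : ℕ → ι) (x : Vec d)
    (y : ι → Bool) (_ : ℝ≥0) : Vec d :=
  coinReveal (a • chainGrad w (lam⁻¹ • x)) (prog x) (p (c (prog x))) (y (c (prog x)))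

lemma prog_smul_chainGrad_le (a lam : ℝ) (w : ℕ → ℝ) (x : Vec d) :
    prog (a • chainGrad w (lam⁻¹ • x)) ≤ prog x + 1 :=
  (prog_smul_le _ _).trans <| prog_le_iff.2 fun _ hj =>
    chainGrad_eq_zero_of_prog_lt w ((prog_smul_le _ _).trans_lt (Nat.lt_of_succ_le hj))

lemma gatedBy_coinGrad (a lam : ℝ) (w : Fin n → ℕ → ℝ) (p : ι → unitInterval)
    (c : Fin n → ℕ → ι) :
    GatedBy (fun i => coinGrad (d := d) a lam (w i) p (c i)) (fun i N y => y (c i N)) := by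
  intro i x y t N hN
  have hgrad := prog_smul_chainGrad_le a lam (w i) x
  have hsucc : prog (coinGrad a lam (w i) p (c i) x y t) ≤ prog x + 1 :=
    prog_coinReveal_le_succ hgrad _ _
  refine ⟨hsucc.trans (Nat.succ_le_succ hN), fun htails => ?_⟩
  rcases hN.lt_or_eq with hlt | rfl
  · exact hsucc.trans hlt
  · simp only [coinGrad, htails]
    exact prog_coinReveal_false_le hgrad _

lemma isStochasticGradient_coinGrad [Fintype ι] {a lam σ : ℝ} (hlam : lam ≠ 0) {w : ℕ → ℝ}
    (hw : ∀ j, 0 ≤ w j) {p : ι → unitInterval} {c : ℕ → ι}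
    (hvar : ∀ j, (a * w j) ^ 2 * (1 - p (c j)) ≤ σ ^ 2 * p (c j)) :
    IsStochasticGradient σ (coinLaw p) (scaledChain a lam w : Vec d → ℝ)
      (coinGrad a lam w p c) := by
  refine isStochasticGradient_coinReveal (gradient_scaledChain w a hlam) prog
    (fun x => c (prog x)) fun x => le_trans ?_ (hvar (prog x))
  have hp : (0 : ℝ) ≤ 1 - p (c (prog x)) := sub_nonneg.2 (p _).2.2
  have hpart : ‖coordPart (a • chainGrad w (lam⁻¹ • x)) (prog x)‖ ≤ |a * w (prog x)| := by
    refine norm_coordPart_le (abs_nonneg _) fun h => ?_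
    rw [PiLp.smul_apply, smul_eq_mul, abs_mul, abs_mul, abs_of_nonneg (hw _)]
    gcongr
    exact abs_chainGrad_le_of_prog_le (j := ⟨prog x, h⟩) (hw _) (prog_smul_le _ _)
  rw [← sq_abs (a * w (prog x))]
  gcongr

/-- The weights of the `K * m + 1` links of a chain whose links come in blocks of length `m`, with
weight `w b` in block `b`. -/
def linkWeights (K m : ℕ) (w : ℕ → ℝ) (j : ℕ) : ℝ := if j ≤ K * m then w (j / m) else 0

lemma linkWeights_nonneg (K m : ℕ) {w : ℕ → ℝ} (hw : ∀ b, 0 ≤ w b) (j : ℕ) :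
    0 ≤ linkWeights K m w j := by
  unfold linkWeights
  split_ifs
  exacts [hw _, le_rfl]

lemma linkWeights_one_le_one (K m j : ℕ) : linkWeights K m (fun _ => 1) j ≤ 1 := by
  unfold linkWeights
  split_ifs <;> norm_num

lemma sum_linkWeights_one_le (K m N : ℕ) :
    ∑ j ∈ Finset.range N, linkWeights K m (fun _ => 1) j ≤ K * m + 1 := by
  simp only [linkWeights, Finset.sum_boole]
  have hsub : (Finset.range N).filter (· ≤ K * m) ⊆ Finset.range (K * m + 1) := fun j hj =>
    Finset.mem_range.2 (Nat.lt_succ_of_le (Finset.mem_filter.1 hj).2)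
  exact_mod_cast (Finset.card_le_card hsub).trans_eq (Finset.card_range _)

lemma average_linkWeights (hn : 0 < n) (K m : ℕ) {w : ℕ → Fin n → ℝ} (hw : ∀ b, ∑ i, w b i = n)
    (j : ℕ) : 1 / n * ∑ i, linkWeights K m (w · i) j = linkWeights K m (fun _ => 1) j := by
  unfold linkWeights
  split_ifs
  · rw [hw, one_div_mul_cancel (by positivity)]
  · simp

lemma sq_div_sixteen_le_norm_gradient_scaledChain_sq {a lam : ℝ} (hlam : lam ≠ 0) {K m : ℕ}
    (hd : K * m + 1 ≤ d) {x : Vec d} (hx : prog x ≤ K * m) :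
    a ^ 2 / 16 ≤ ‖gradient (scaledChain a lam (linkWeights K m fun _ => 1)) x‖ ^ 2 := by
  have hnext : paddedCoord (lam⁻¹ • x) (K * m + 1) < 1 := by
    rw [paddedCoord_eq_zero_of_prog_lt
      (((prog_smul_le _ x).trans hx).trans_lt (Nat.lt_succ_self _))]
    exact one_pos
  have hquarter : 1 / 4 ≤ ‖chainGrad (linkWeights K m fun _ => 1) (lam⁻¹ • x)‖ :=
    quarter_le_norm_chainGrad (linkWeights_nonneg K m fun _ => zero_le_one) hd
      (fun j hj => (if_pos (Nat.lt_succ_iff.1 hj)).ge) hnext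
  rw [gradient_scaledChain _ _ hlam, norm_smul, mul_pow, Real.norm_eq_abs, sq_abs]
  nlinarith [pow_le_pow_left₀ (by norm_num) hquarter 2, sq_nonneg a]

/-- Local functions `f` and stochastic gradients `g` with noise law `D` that satisfy the assumptions
on the problem, and for which every zero-respecting algorithm has, up to time `τ`, an expected best
squared gradient norm above `ε`. -/
structure IsHardInstance {Ξ : Type} [MeasurableSpace Ξ] (v : Fin n → ℝ → ℝ) (L Δ σ ε : ℝ)
    (τ : ℝ≥0∞) (f : Fin n → Vec d → ℝ) (D : Measure Ξ) [IsProbabilityMeasure D]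
    (g : Fin n → Vec d → Ξ → ℝ≥0 → Vec d) : Prop where
  differentiable : ∀ i, Differentiable ℝ (f i)
  inClass : InClass L Δ (average f)
  isStochasticGradient : ∀ i, IsStochasticGradient σ D (f i) (g i)
  lt_integral : ∀ A : Algorithm n d, IsZeroRespecting A → ∀ t ≤ τ,
    Integrable (bestSqGrad v g A (average f) t) (draws D) ∧
      ε < ∫ ξ, bestSqGrad v g A (average f) t ξ ∂draws D

/-- The coin that worker `i` tosses in block `b`, among one coin for each worker and each of the
blocks `0, …, K`. For `K < b` the index wraps around. -/
def blockCoin (K : ℕ) (i : Fin n) (b : ℕ) : Fin n × Fin (K + 1) := (i, Fin.ofNat (K + 1) b)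

lemma blockCoin_snd_val {K b : ℕ} (i : Fin n) (hb : b ≤ K) : ((blockCoin K i b).2 : ℕ) = b :=
  Nat.mod_eq_of_lt (Nat.lt_succ_of_le hb)

lemma variance_linkWeights_le {a σ : ℝ} {w : ℕ → ℝ} {p : ℕ → Fin n → unitInterval} {i : Fin n}
    (hvar : ∀ b, (a * w b) ^ 2 * (1 - p b i) ≤ σ ^ 2 * p b i) (K m j : ℕ) :
    (a * linkWeights K m w j) ^ 2 * (1 - p (blockCoin K i (j / m)).2 i) ≤
      σ ^ 2 * p (blockCoin K i (j / m)).2 i := by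
  unfold linkWeights
  split_ifs with hj
  · rw [blockCoin_snd_val i (Nat.div_le_of_le_mul ((mul_comm K m) ▸ hj))]
    exact hvar (j / m)
  · have hp := (p (blockCoin K i (j / m)).2 i).2.1
    rw [mul_zero, zero_pow two_ne_zero, zero_mul]
    positivity

theorem isHardInstance_of_isBlockDesign (hn : 0 < n) {v : Fin n → ℝ → ℝ}
    (hfin : ∀ i, ∀ t ≠ ⊤, work (v i) t ≠ ⊤) {L Δ ε σ a ℓ : ℝ} (hL : 0 < L) (hε : 0 < ε)
    (ha : 0 < a) (haε : a ^ 2 = 32 * ε) {K m : ℕ} (hm : 8 * ℓ ≤ m)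
    (hgap : 2304 * (K * m + 1) * ε ≤ L * Δ) (hK : K * Real.exp (-(m / 4)) < 1 / 2)
    (hd : K * m + 1 ≤ d) {T : ℕ → ℝ≥0∞} (hT : T 0 = 0) {w : ℕ → Fin n → ℝ}
    {p : ℕ → Fin n → unitInterval}
    (hdesign : ∀ b, IsBlockDesign a ℓ σ
      (fun i => work (v i) (T (b + 1)) - work (v i) (T b)) (w b) (p b)) :
    IsHardInstance v L Δ σ ε (T K)
      (fun i => (scaledChain a (18 * a / L) (linkWeights K m (w · i)) : Vec d → ℝ))
      (coinLaw fun z : Fin n × Fin (K + 1) => p z.2 z.1)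
      (fun i => coinGrad a (18 * a / L) (linkWeights K m (w · i)) (fun z => p z.2 z.1)
        fun N => blockCoin K i (N / m)) := by
  have hlam : 18 * a / L ≠ 0 := by positivity
  have haverage : average (fun i => (scaledChain a (18 * a / L) (linkWeights K m (w · i)) :
      Vec d → ℝ)) = scaledChain a (18 * a / L) (linkWeights K m fun _ => 1) := by
    rw [average_scaledChain, funext (average_linkWeights hn K m fun b => (hdesign b).sum_eq)]
  refine ⟨fun i x => (hasGradientAt_scaledChain _ a hlam x).differentiableAt, ?_, fun i => ?_,
    fun A hA t ht => ⟨integrable_bestSqGrad v _ _ t _ hA, ?_⟩⟩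
  · rw [haverage]
    refine inClass_scaledChain hL ha (linkWeights_nonneg K m fun _ => zero_le_one)
      (linkWeights_one_le_one K m) (le_trans ?_ hgap)
    rw [haε]
    nlinarith [sum_linkWeights_one_le K m (d + 1)]
  · exact isStochasticGradient_coinGrad hlam
      (linkWeights_nonneg K m fun b => (hdesign b).nonneg i)
      (variance_linkWeights_le (fun b => (hdesign b).variance_le i) K m)
  · rw [haverage]
    refine lt_integral_bestSqGrad hA hfin (coin := fun i b y => y (blockCoin K i b))
      (p := fun b i => p b i) (gatedBy_coinGrad _ _ _ _ fun i N => blockCoin K i (N / m))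
      (fun b hb i => ?_) hT (fun b _ => ?_) hK hε (fun x hx => ?_) ht
    · rw [coinLaw_real_heads, blockCoin_snd_val i hb.le]
      rfl
    · exact (hdesign b).work_le.trans (ENNReal.ofReal_le_ofReal (by linarith))
    · linarith [sq_div_sixteen_le_norm_gradient_scaledChain_sq (a := a) hlam hd hx]

theorem exists_isHardInstance (hn : 0 < n) {v : Fin n → ℝ → ℝ}
    (hv : ∀ i, ∀ T, IntegrableOn (v i) (Set.Icc 0 T)) {L Δ ε ℓ : ℝ} (hL : 0 < L) (hε : 0 < ε)
    (hℓ : 1 ≤ ℓ) (σ : ℝ) {K m : ℕ} (hm : 8 * ℓ ≤ m) (hgap : 2304 * (K * m + 1) * ε ≤ L * Δ)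
    (hK : K * Real.exp (-(m / 4)) < 1 / 2) (hd : K * m + 1 ≤ d) :
    ∃ (f : Fin n → Vec d → ℝ) (Ξ : Type) (_ : MeasurableSpace Ξ) (D : Measure Ξ)
      (_ : IsProbabilityMeasure D) (g : Fin n → Vec d → Ξ → ℝ≥0 → Vec d),
      IsHardInstance v L Δ σ ε (lowerTime v (1 / 64) 1 ℓ σ ε K) f D g := by
  have hfin (i : Fin n) (t : ℝ≥0∞) (ht : t ≠ ⊤) : work (v i) t ≠ ⊤ := work_ne_top (hv i) ht
  have ha : 0 < √(32 * ε) := by positivity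
  have haε : √(32 * ε) ^ 2 = 32 * ε := Real.sq_sqrt (by positivity)
  have hwindow (b : ℕ) : lowerTime v (1 / 64) 1 ℓ σ ε (b + 1) =
      windowEnd v ℓ (σ ^ 2 / (2 * n * √(32 * ε) ^ 2)) (lowerTime v (1 / 64) 1 ℓ σ ε b) := by
    rw [lowerTime_succ, haε]
    congr 1
    field_simp
    ring
  choose w p hdesign using fun b : ℕ =>
    exists_isBlockDesign_windowEnd hn hfin ha hℓ σ (lowerTime v (1 / 64) 1 ℓ σ ε b)
  simp only [← hwindow] at hdesign
  exact ⟨_, _, _, _, _, _,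
    isHardInstance_of_isBlockDesign hn hfin hL hε ha haε hm hgap hK hd rfl hdesign⟩

end Instance

/-! ### The number and the length of the blocks -/

section Constants

/-- The number of blocks of the chain, as a function of `x = LΔ/ε`. -/
def blockCount (x : ℝ) : ℕ := ⌊1 / 41472 * x / Real.log x⌋₊

/-- The length of the blocks of the chain, as a function of `x = LΔ/ε`. -/
def blockLength (x : ℝ) : ℕ := ⌈8 * Real.log x⌉₊

variable {x : ℝ}

lemma one_le_log_of_three_le (hx : 3 ≤ x) : 1 ≤ Real.log x := by
  rw [Real.le_log_iff_exp_le (by linarith)]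
  linarith [Real.exp_one_lt_d9]

lemma blockCount_mul_log_le (hx : 3 ≤ x) : blockCount x * Real.log x ≤ 1 / 41472 * x := by
  have hlog := one_le_log_of_three_le hx
  rw [← le_div_iff₀ (by linarith)]
  exact Nat.floor_le (by positivity)

lemma eight_mul_log_le_blockLength (x : ℝ) : 8 * Real.log x ≤ blockLength x := Nat.le_ceil _

lemma blockLength_le (hx : 3 ≤ x) : blockLength x ≤ 9 * Real.log x := by
  have hlog := one_le_log_of_three_le hx
  have hceil := Nat.ceil_lt_add_one (a := 8 * Real.log x) (by linarith)
  rw [blockLength]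
  linarith

lemma blockCount_mul_blockLength_add_one_le (hx : 4608 ≤ x) :
    2304 * (blockCount x * blockLength x + 1) ≤ x := by
  have hlength := blockLength_le (x := x) (by linarith)
  have hcount := blockCount_mul_log_le (x := x) (by linarith)
  nlinarith [mul_le_mul_of_nonneg_left hlength (Nat.cast_nonneg (α := ℝ) (blockCount x))]

lemma blockCount_mul_exp_lt_half (hx : 3 ≤ x) :
    blockCount x * Real.exp (-(blockLength x / 4)) < 1 / 2 := by
  have hlog := one_le_log_of_three_le hx
  have hexp : Real.exp (-(blockLength x / 4)) ≤ x⁻¹ := by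
    rw [← Real.exp_log (by positivity : 0 < x⁻¹), Real.log_inv, Real.exp_le_exp]
    linarith [eight_mul_log_le_blockLength x]
  have hcount : (blockCount x : ℝ) ≤ 1 / 41472 * x :=
    (le_mul_of_one_le_right (Nat.cast_nonneg _) hlog).trans (blockCount_mul_log_le hx)
  calc blockCount x * Real.exp (-(blockLength x / 4)) ≤ 1 / 41472 * x * x⁻¹ := by gcongr
    _ = 1 / 41472 := by field_simp
    _ < 1 / 2 := by norm_num

end Constants


end TimeOracle

end

theorem theorem5_general :
    ∃ c' c₁ c₂ c₃ : ℝ, 0 < c' ∧ 0 < c₁ ∧ 0 < c₂ ∧ 0 < c₃ ∧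
      ∀ (L Δ ε : ℝ), 0 < L → 0 < ε → ε < c' * (L * Δ) →
      ∃ d₀ : ℕ, ∀ d : ℕ, d₀ ≤ d →
      ∀ (n : ℕ), 0 < n →
      ∀ (v : Fin n → ℝ → ℝ), (∀ i, ∀ τ, 0 ≤ τ → 0 ≤ v i τ) →
      (∀ i, ∀ T, MeasureTheory.IntegrableOn (v i) (Set.Icc 0 T)) →
      ∀ σ : ℝ,
      ∃ (f : Fin n → TimeOracle.Vec d → ℝ)
        (Ξ : Type) (_ : MeasurableSpace Ξ) (D : MeasureTheory.Measure Ξ)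
        (_ : MeasureTheory.IsProbabilityMeasure D)
        (g : Fin n → TimeOracle.Vec d → Ξ → NNReal → TimeOracle.Vec d),
        TimeOracle.IsHardInstance v L Δ σ ε
          (TimeOracle.lowerTime v c₂ c₃ (Real.log (L * Δ / ε)) σ ε
            ⌊c₁ * (L * Δ / ε) / Real.log (L * Δ / ε)⌋₊) f D g := by
  refine ⟨1 / 4608, 1 / 41472, 1 / 64, 1, by norm_num, by norm_num, by norm_num, by norm_num,
    fun L Δ ε hL hε hsmall => ?_⟩
  have hx : 4608 < L * Δ / ε := by
    rw [lt_div_iff₀ hε]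
    linarith
  have hx3 : 3 ≤ L * Δ / ε := by linarith
  refine ⟨TimeOracle.blockCount (L * Δ / ε) * TimeOracle.blockLength (L * Δ / ε) + 1,
    fun d hd n hn v _ hv σ => ?_⟩
  exact TimeOracle.exists_isHardInstance hn hv hL hε (TimeOracle.one_le_log_of_three_le hx3) σ
    (TimeOracle.eight_mul_log_le_blockLength _)
    ((le_div_iff₀ hε).1 (TimeOracle.blockCount_mul_blockLength_add_one_le hx.le))
    (TimeOracle.blockCount_mul_exp_lt_half hx3) hd

theorem theorem5 :
    ∃ c' c₁ c₂ c₃ : ℝ, 0 < c' ∧ 0 < c₁ ∧ 0 < c₂ ∧ 0 < c₃ ∧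
      ∀ (n : ℕ), 0 < n →
      ∀ (v : Fin n → ℝ → ℝ), (∀ i, TimeOracle.IsComputationPower (v i)) →
      ∀ (L Δ ε σ : ℝ), 0 < L → 0 < Δ → 0 < ε → 0 ≤ σ → ε < c' * (L * Δ) →
      -- in every sufficiently large dimension
      ∃ d₀ : ℕ, ∀ d : ℕ, d₀ ≤ d →
      ∀ (A : TimeOracle.Algorithm n d), TimeOracle.IsZeroRespecting A →
      ∃ (f : Fin n → TimeOracle.Vec d → ℝ)
        (Ξ : Type) (_ : MeasurableSpace Ξ) (D : MeasureTheory.Measure Ξ)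
        (_ : MeasureTheory.IsProbabilityMeasure D)
        (g : Fin n → TimeOracle.Vec d → Ξ → NNReal → TimeOracle.Vec d),
        (∀ i, Differentiable ℝ (f i)) ∧
        TimeOracle.InClass L Δ (TimeOracle.average f) ∧
        (∀ i, TimeOracle.IsStochasticGradient σ D (f i) (g i)) ∧
        ∀ t : ENNReal,
          t = TimeOracle.lowerTime v c₂ c₃ (Real.log (L * Δ / ε)) σ ε
                ⌊c₁ * (L * Δ / ε) / Real.log (L * Δ / ε)⌋₊ / 2 →
          -- the draws `ξ 0, ξ 1, …` of the oracles are independent with law `D`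
          MeasureTheory.Integrable
            (TimeOracle.bestSqGrad v g A (TimeOracle.average f) t)
            (MeasureTheory.Measure.infinitePi (fun _ : ℕ => D)) ∧
          ε < ∫ ξ, TimeOracle.bestSqGrad v g A (TimeOracle.average f) t ξ
                ∂(MeasureTheory.Measure.infinitePi (fun _ : ℕ => D)) := by
  obtain ⟨c', c₁, c₂, c₃, hc', hc₁, hc₂, hc₃, hgeneral⟩ := theorem5_general
  refine ⟨c', c₁, c₂, c₃, hc', hc₁, hc₂, hc₃, fun n hn v hv L Δ ε σ hL _ hε _ hsmall => ?_⟩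
  obtain ⟨d₀, hd₀⟩ := hgeneral L Δ ε hL hε hsmall
  refine ⟨d₀, fun d hd A hA => ?_⟩
  obtain ⟨f, Ξ, hΞ, D, hD, g, hhard⟩ :=
    hd₀ d hd n hn v (fun i => (hv i).nonneg) (fun i => (hv i).integrableOn) σ
  exact ⟨f, Ξ, hΞ, D, hD, g, hhard.differentiable, hhard.inClass, hhard.isStochasticGradient,
    fun t ht => hhard.lt_integral A hA t (ht ▸ ENNReal.half_le_self)⟩
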